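/- **Setting.** Let $(\mathcal X,\mathcal B)$ be a measurable space, $X=\{X_n\}_{n\ge1}$ an $\mathcal X$-valued random process, and $P$ a probability kernel from $\mathcal X$ to $\mathbb R$; write $F_x$ for the distribution function of $P(x,\cdot)$. For $n\ge1$ let $\{\xi_n^x\}_{x\in\mathcal X}$ be families of real random variables, jointly measurable in $(x,\omega)$, mutually independent in $n$ and jointly independent of $X$, such that each $\xi_n^x$ has distribution $F_x$. (Precisely: there are $\sigma$-algebras $\mathcal G_n$, $n\ge1$, mutually independent and jointly independent of $\sigma(X)$, such that $(x,\omega)\mapsto\xi_n^x(\omega)$ is $\mathcal B\otimes\mathcal G_n$-measurable for each $n$.) Put $$S_0=0,\quad S_n=\sum_{i=1}^n\xi_i^{X_i},\quad M=\sup_{n\ge0}S_n,\quad \mu(y)=\min\{n\ge1:\ S_n>y\}\quad(y>0).$$ For a distribution $H$ on $\mathbb R$ let $\overline H(y)=1-H(y)$, and let $H^s$ be the distribution with tail $\overline H^s(y)=\min\bigl(1,\int_y^\infty\overline H(t)\,dt\bigr)$. A distribution $H$ on $[0,\infty)$ is *subexponential* if $\overline H(y)>0$ for all $y$ and $\overline{H^{*2}}(y)/\overline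 H(y)\to2$ as $y\to\infty$; a distribution on $\mathbb R$ is called subexponential if the law of the positive part of a random variable with that distribution is subexponential. Assume that every $F_x$ has a finite mean, and that there are a distribution $F$ on $[0,\infty)$ with finite mean, a measurable function $c:\mathcal X\to[0,\infty)$ and a constant $L<\infty$ such that $$\overline F_x(y)\sim c(x)\overline F(y)\ \text{ as }y\to\infty,\ \text{ for all }x\in\mathcal X,\qquad \overline F_x(y)\le L\,\overline F(y)\ \text{ for all }x\in\mathcal X,\ y\ge0,$$ where for $c(x)=0$ the first relation means $\overline F_x(y)=o(\overline F(y))$. **Theorem.** Assume further that: * (C1) there are a probability measure $\pi$ on $(\mathcal X,\mathcal B)$ and a positive integer $d$ such that $\frac1d\sum_{j=0}^{d-1}\mathbf P(X_{n+j}\in\cdot)\to\pi$ in total variation as $n\to\infty$; * (C2) $S_n/n\to-a$ almost surely as $n\to\infty$, for some constant $a>0$; * $F^s$ is subexponential; * there is a distribution $G$ on $\mathbb R$ with negative mean $\int t\,dG(t)<0$ such that $\overline F_x(y)\le\overline G(y)$ for all $x\in\mathcal X$ and $y\in\mathbb R$. Then, with $C(B)=\int_Bc(x)\,\pi(dx)$,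 $$\lim_{y\to\infty}\frac{\mathbf P(M>y,\ X_{\mu(y)}\in B)}{\overline F^s(y)}=\frac{C(B)}a\qquad\text{for every }B\in\mathcal B.$$ -/

import Mathlib

open MeasureTheory ProbabilityTheory Filter Topology Set
open scoped ENNReal Asymptotics

noncomputable section

namespace ModulatedWalk

/-! Distributions on `ℝ` are probability measures on the Borel sets of `ℝ`. -/

/-- The tail `H̄(y) = 1 - H(y) = H((y, ∞))` of a distribution `H` on `ℝ`. -/
def tail (H : Measure ℝ) (y : ℝ) : ℝ := H.real (Ioi y)

/-- `min (1, ∫_y^∞ H̄(t) dt)`, the tail of the integrated (second-tail) distribution of `H`. -/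
def secondTail (H : Measure ℝ) (y : ℝ) : ℝ :=
  (min 1 (∫⁻ t in Ioi y, H (Ioi t))).toReal

theorem secondTail_antitone (H : Measure ℝ) : Antitone (secondTail H) := by
  intro x y hxy
  refine ENNReal.toReal_mono (by simp) (min_le_min_left _ ?_)
  exact lintegral_mono_set (Ioi_subset_Ioi hxy)

theorem secondTail_rightContinuous (H : Measure ℝ) (x : ℝ) :
    ContinuousWithinAt (secondTail H) (Ici x) x := by
  rw [← continuousWithinAt_Ioi_iff_Ici]
  set ν : Measure ℝ := volume.withDensity (fun t => H (Ioi t)) with hν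
  have hφ : ∀ y, ∫⁻ t in Ioi y, H (Ioi t) = ν (Ioi y) := fun y =>
    (withDensity_apply _ measurableSet_Ioi).symm
  have key : Tendsto (fun y => ν (Ioi y)) (𝓝[>] x) (𝓝 (ν (Ioi x))) := by
    obtain ⟨u, hu, hux, hul⟩ := exists_seq_strictAnti_tendsto x
    have hUn : ⋃ n, Ioi (u n) = Ioi x := by
      ext z
      simp only [mem_iUnion, mem_Ioi]
      constructor
      · rintro ⟨n, hn⟩
        exact (hux n).trans hn
      · intro hz
        exact (hul.eventually (gt_mem_nhds hz)).exists
    have hlim : Tendsto (fun n => ν (Ioi (u n))) atTop (𝓝 (ν (Ioi x))) := by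
      have h := tendsto_measure_iUnion_atTop (μ := ν) (s := fun n => Ioi (u n))
        (fun i j hij => Ioi_subset_Ioi (hu.antitone hij))
      rwa [hUn] at h
    refine tendsto_order.2 ⟨fun a ha => ?_, fun a ha => ?_⟩
    · obtain ⟨n, hn⟩ := (hlim.eventually (lt_mem_nhds ha)).exists
      filter_upwards [Ioo_mem_nhdsGT (hux n)] with y hy
      exact hn.trans_le (measure_mono (Ioi_subset_Ioi hy.2.le))
    · filter_upwards [self_mem_nhdsWithin] with y hy
      exact (measure_mono (Ioi_subset_Ioi (le_of_lt hy))).trans_lt ha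
  have h1 : Tendsto (fun y => min 1 (ν (Ioi y))) (𝓝[>] x) (𝓝 (min 1 (ν (Ioi x)))) :=
    tendsto_const_nhds.min key
  have h2 : secondTail H = fun y => (min 1 (ν (Ioi y))).toReal :=
    funext fun y => by rw [secondTail, hφ y]
  rw [h2]
  exact (ENNReal.tendsto_toReal (by simp)).comp h1

/-- The distribution function `y ↦ 1 - min (1, ∫_y^∞ H̄(t) dt)` of the second-tail distribution. -/
def secondTailCDF (H : Measure ℝ) : StieltjesFunction ℝ where
  toFun y := 1 - secondTail H y
  mono' _ _ h := sub_le_sub_left (secondTail_antitone H h) 1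
  right_continuous' x := continuousWithinAt_const.sub (secondTail_rightContinuous H x)

/-- The integrated, or second-tail, distribution `H^s`. -/
def secondTailDist (H : Measure ℝ) : Measure ℝ := (secondTailCDF H).measure

/-- The law of the positive part `max (ζ, 0)` of a random variable `ζ` with law `H`; it is `H`
itself when `H` is carried by `[0, ∞)`. -/
def positivePart (H : Measure ℝ) : Measure ℝ := H.map (fun t => max t 0)

/-- Subexponentiality: `H̄ > 0` everywhere and `H̄^{*2}(y) / H̄(y) → 2`. The ratio condition is
imposed on the positive part of `H`, which is `H` itself for distributions on `[0, ∞)`. -/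
def Subexponential (H : Measure ℝ) : Prop :=
  (∀ y, 0 < tail H y) ∧
    Tendsto (fun y => tail ((positivePart H).conv (positivePart H)) y / tail (positivePart H) y)
      atTop (𝓝 2)

/-- The total variation distance `sup_B |μ(B) - ν(B)|` of two finite measures, the supremum being
over all measurable sets. -/
def tvDist {E : Type*} [MeasurableSpace E] (μ ν : Measure E) : ℝ :=
  ⨆ B : {B : Set E // MeasurableSet B}, |μ.real B - ν.real B|

section Walk

variable {E Ω : Type*} [mE : MeasurableSpace E] [mΩ : MeasurableSpace Ω]

/-- Processes are indexed by `n ≥ 1`; the value at index `0` is never used.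
`X 1, X 2, …` is an `E`-valued random process and `ξ n x` (`n ≥ 1`, `x ∈ E`) are real random
variables such that
* `ξ n x` has law `P x`;
* the families `(ξ n x)_{x ∈ E}` are mutually independent in `n`, and jointly independent of `X`.

As the family `(ξ n x)_x` is to be evaluated at the random point `X n`, its randomness is carried
by a `σ`-algebra `𝒢 n` for which it is jointly measurable in `x` and `ω`, and the independence is
that of the `𝒢 n`, `n ≥ 1`, and of `σ(X 1, X 2, …)`. -/
structure IsModulated (Pr : Measure Ω) (P : Kernel E ℝ) (X : ℕ → Ω → E) (ξ : ℕ → E → Ω → ℝ) :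
    Prop where
  measurable_X : ∀ n, 1 ≤ n → Measurable (X n)
  law : ∀ n, 1 ≤ n → ∀ x, Pr.map (ξ n x) = P x
  indep : ∃ 𝒢 : ℕ+ → MeasurableSpace Ω,
    (∀ n, 𝒢 n ≤ mΩ) ∧
    (∀ n, Measurable[mE.prod (𝒢 n)] (fun p : E × Ω => ξ n p.1 p.2)) ∧
    iIndep 𝒢 Pr ∧
    Indep (⨆ n, 𝒢 n) (⨆ n : ℕ+, mE.comap (X n)) Pr

/-- `S_n = ξ_1^{X_1} + ⋯ + ξ_n^{X_n}`, with `S_0 = 0`. -/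
def walk (X : ℕ → Ω → E) (ξ : ℕ → E → Ω → ℝ) (n : ℕ) (ω : Ω) : ℝ :=
  ∑ i ∈ Finset.Icc 1 n, ξ i (X i ω) ω

/-- `M = sup_{n ≥ 0} S_n`, possibly `+∞`. -/
def walkSup (X : ℕ → Ω → E) (ξ : ℕ → E → Ω → ℝ) (ω : Ω) : EReal :=
  ⨆ n : ℕ, (walk X ξ n ω : EReal)

/-- `μ(y) = min {n ≥ 1 : S_n > y}`. For `y ≥ 0` the set is nonempty exactly if `M > y`; the value
is only used on that event. -/
def passageTime (X : ℕ → Ω → E) (ξ : ℕ → E → Ω → ℝ) (y : ℝ) (ω : Ω) : ℕ :=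
  sInf {n : ℕ | 1 ≤ n ∧ y < walk X ξ n ω}

/-- The averages over `d` consecutive times of the laws of `X_n` converge to `π` in total
variation. -/
def ConvergesInMean (Pr : Measure Ω) (X : ℕ → Ω → E) (d : ℕ) (π : Measure E) : Prop :=
  Tendsto
    (fun n : ℕ => tvDist ((d : ℝ≥0∞)⁻¹ • ∑ j ∈ Finset.range d, Pr.map (X (n + j))) π)
    atTop (𝓝 0)

/-- `S_n / n → -a` almost surely. -/
def HasDrift (Pr : Measure Ω) (X : ℕ → Ω → E) (ξ : ℕ → E → Ω → ℝ) (a : ℝ) : Prop :=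
  ∀ᵐ ω ∂Pr, Tendsto (fun n : ℕ => walk X ξ n ω / n) atTop (𝓝 (-a))

end Walk

end ModulatedWalk

end

/-! The supremum is large because of a single big jump. At time `n` the walk is near `-a n`, so a
jump at time `n` carries it over `y` when it exceeds about `y + a n`; summing over `n`, and
replacing the law of `X n` by `π` on blocks of length `d`, the expected number of such jumps with
`X n ∈ B` is asymptotically `(C(B) / a) * F^s(y, ∞)`.

This number is a lower bound for `P(M > y, X_{μ(y)} ∈ B)` up to a small relative error, since the
past is typical with probability close to one uniformly in `n`. For the upper bound, over all of
the state space, decompose at the first passage over a barrier `K - α n` with `α < a`. Either it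
is a jump over `y - K + α n`, or the walk has only been brought to some level and must climb from
there; the law of that level has small mass and a tail of order `F^s`, and the remaining climb is
dominated by the supremum of an i.i.d. walk with negative drift. That supremum has tail `O(F^s)`:
applying the same decomposition to the i.i.d. walk itself bounds the ratio of the two tails by a
contraction. The lower bounds for `B` and `Bᶜ` and the upper bound for their sum give the limit. -/

namespace ModulatedWalk

/-! ### Subexponential distributions -/

section Subexponential

theorem tendsto_measure_Ioi_atTop {ν : Measure ℝ} (h : ∃ y, ν (Ioi y) ≠ ∞) :
    Tendsto (fun y => ν (Ioi y)) atTop (𝓝 0) := by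
  have hempty : ⋂ y : ℝ, Ioi y = ∅ :=
    eq_empty_of_forall_notMem fun z hz => lt_irrefl z (mem_iInter.1 hz z)
  rw [← measure_empty (μ := ν), ← hempty]
  exact tendsto_measure_iInter_atTop (fun _ => measurableSet_Ioi.nullMeasurableSet)
    (fun _ _ => Ioi_subset_Ioi) h

theorem positivePart_Ioi (H : Measure ℝ) {y : ℝ} (hy : 0 ≤ y) :
    positivePart H (Ioi y) = H (Ioi y) := by
  rw [positivePart, Measure.map_apply (by fun_prop) measurableSet_Ioi]
  congr 1
  ext t
  simp [not_lt.2 hy]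

theorem positivePart_Iio_zero (H : Measure ℝ) : positivePart H (Iio 0) = 0 := by
  rw [positivePart, Measure.map_apply (by fun_prop) measurableSet_Iio]
  convert measure_empty (μ := H)
  ext t
  simp

variable {Q : Measure ℝ} [IsProbabilityMeasure Q]

theorem measureReal_prod_le_tail_conv (hQ : Q (Iio 0) = 0) {y : ℝ} {s : Set (ℝ × ℝ)}
    (hs : ∀ p ∈ s, 0 ≤ p.1 → 0 ≤ p.2 → y < p.1 + p.2) :
    (Q.prod Q).real s ≤ tail (Q.conv Q) y := by
  have hnonneg : ∀ᵐ x ∂Q, 0 ≤ x := by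
    simpa only [ae_iff, not_le, Iio] using hQ
  rw [tail, Measure.conv, map_measureReal_apply (by fun_prop) measurableSet_Ioi]
  refine ENNReal.toReal_mono (measure_ne_top _ _) (measure_mono_ae ?_)
  filter_upwards [Measure.quasiMeasurePreserving_fst.ae hnonneg,
    Measure.quasiMeasurePreserving_snd.ae hnonneg] with p h1 h2 hp
  exact hs p hp h1 h2

theorem tail_conv_ge_of_fst_large (hQ : Q (Iio 0) = 0) {h y : ℝ} (hy : h ≤ y) :
    tail Q y + (1 - tail Q h) * tail Q y + (tail Q h - tail Q y) * tail Q (y - h)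
      ≤ tail (Q.conv Q) y := by
  have hIic : Q.real (Iic h) = 1 - tail Q h := by
    rw [← compl_Ioi, probReal_compl_eq_one_sub measurableSet_Ioi, tail]
  have hIoc : Q.real (Ioc h y) = tail Q h - tail Q y := by
    rw [← Ioi_sdiff_Ioi, measureReal_sdiff (Ioi_subset_Ioi hy) measurableSet_Ioi, tail, tail]
  have hdisj : Disjoint (Ioi y ×ˢ (univ : Set ℝ)) (Iic h ×ˢ Ioi y) :=
    Disjoint.set_prod_left (Iic_disjoint_Ioi hy).symm _ _
  have hdisj' : Disjoint (Ioi y ×ˢ univ ∪ Iic h ×ˢ Ioi y) (Ioc h y ×ˢ Ioi (y - h)) :=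
    (Disjoint.set_prod_left (Ioc_disjoint_Ioi_same).symm _ _).union_left
      (Disjoint.set_prod_left (Iic_disjoint_Ioc le_rfl) _ _)
  calc tail Q y + (1 - tail Q h) * tail Q y + (tail Q h - tail Q y) * tail Q (y - h)
      = (Q.prod Q).real (Ioi y ×ˢ univ ∪ Iic h ×ˢ Ioi y ∪ Ioc h y ×ˢ Ioi (y - h)) := by
        rw [measureReal_union hdisj' (measurableSet_Ioc.prod measurableSet_Ioi),
          measureReal_union hdisj (measurableSet_Iic.prod measurableSet_Ioi),
          measureReal_prod_prod, measureReal_prod_prod, measureReal_prod_prod, hIic, hIoc,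
          probReal_univ, mul_one, tail, tail, tail]
    _ ≤ tail (Q.conv Q) y := by
        refine measureReal_prod_le_tail_conv hQ ?_
        rintro ⟨u, v⟩ ((⟨hu, -⟩ | ⟨-, hv⟩) | ⟨hu, hv⟩) hu0 hv0 <;>
          simp only [mem_Ioi, mem_Ioc] at * <;> linarith

theorem tail_conv_ge_of_both_large (hQ : Q (Iio 0) = 0) {h y : ℝ} (hy : h ≤ y) :
    2 * ((1 - tail Q h) * tail Q y) + (Q.prod Q).real {p | h < p.1 ∧ h < p.2 ∧ y < p.1 + p.2}
      ≤ tail (Q.conv Q) y := by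
  have hIic : Q.real (Iic h) = 1 - tail Q h := by
    rw [← compl_Ioi, probReal_compl_eq_one_sub measurableSet_Ioi, tail]
  have hdisj : Disjoint (Iic h ×ˢ Ioi y) (Ioi y ×ˢ Iic h) :=
    Disjoint.set_prod_left (Iic_disjoint_Ioi hy) _ _
  have hdisj' : Disjoint (Iic h ×ˢ Ioi y ∪ Ioi y ×ˢ Iic h)
      {p : ℝ × ℝ | h < p.1 ∧ h < p.2 ∧ y < p.1 + p.2} := by
    rw [Set.disjoint_left]
    rintro p (⟨hp, -⟩ | ⟨-, hp⟩) ⟨h1, h2, -⟩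
    · exact not_lt.2 hp h1
    · exact not_lt.2 hp h2
  have hmeas : MeasurableSet {p : ℝ × ℝ | h < p.1 ∧ h < p.2 ∧ y < p.1 + p.2} := by measurability
  calc 2 * ((1 - tail Q h) * tail Q y) + (Q.prod Q).real {p | h < p.1 ∧ h < p.2 ∧ y < p.1 + p.2}
      = (Q.prod Q).real (Iic h ×ˢ Ioi y ∪ Ioi y ×ˢ Iic h
          ∪ {p | h < p.1 ∧ h < p.2 ∧ y < p.1 + p.2}) := by
        rw [measureReal_union hdisj' hmeas,
          measureReal_union hdisj (measurableSet_Ioi.prod measurableSet_Iic),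
          measureReal_prod_prod, measureReal_prod_prod, hIic, tail, tail]
        ring
    _ ≤ tail (Q.conv Q) y := by
        refine measureReal_prod_le_tail_conv hQ ?_
        rintro ⟨u, v⟩ ((⟨-, hv⟩ | ⟨hu, -⟩) | ⟨-, -, huv⟩) hu0 hv0 <;>
          simp only [mem_Ioi] at * <;> linarith

theorem tendsto_tail_atTop (Q : Measure ℝ) [IsFiniteMeasure Q] : Tendsto (tail Q) atTop (𝓝 0) :=
  (ENNReal.tendsto_toReal ENNReal.zero_ne_top).comp
    (tendsto_measure_Ioi_atTop ⟨0, measure_ne_top Q _⟩)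

theorem tendsto_tail_sub_div_tail (hQ : Q (Iio 0) = 0) (hpos : ∀ y, 0 < tail Q y)
    (h2 : Tendsto (fun y => tail (Q.conv Q) y / tail Q y) atTop (𝓝 2)) {h : ℝ} (hh : 0 ≤ h) :
    Tendsto (fun y => tail Q (y - h) / tail Q y) atTop (𝓝 1) := by
  have hlim : Tendsto (fun y => (tail (Q.conv Q) y / tail Q y - 2 + tail Q h) /
      (tail Q h - tail Q y)) atTop (𝓝 ((2 - 2 + tail Q h) / (tail Q h - 0))) :=
    ((h2.sub_const 2).add_const _).div ((tendsto_tail_atTop Q).const_sub _)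
      (by simpa using (hpos h).ne')
  rw [sub_self, zero_add, sub_zero, div_self (hpos h).ne'] at hlim
  refine tendsto_of_tendsto_of_tendsto_of_le_of_le' tendsto_const_nhds hlim ?_ ?_
  · refine Eventually.of_forall fun y => (one_le_div (hpos y)).2 ?_
    exact measureReal_mono (Ioi_subset_Ioi (by linarith))
  · filter_upwards [eventually_ge_atTop h,
      (tendsto_tail_atTop Q).eventually (gt_mem_nhds (hpos h))] with y hy hlt
    have hbound := tail_conv_ge_of_fst_large hQ hy
    have hcancel : tail (Q.conv Q) y / tail Q y * tail Q y = tail (Q.conv Q) y :=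
      div_mul_cancel₀ _ (hpos y).ne'
    rw [le_div_iff₀ (sub_pos.2 hlt), div_mul_eq_mul_div, div_le_iff₀ (hpos y)]
    nlinarith

theorem eventually_measureReal_both_large_le (hQ : Q (Iio 0) = 0) (hpos : ∀ y, 0 < tail Q y)
    (h2 : Tendsto (fun y => tail (Q.conv Q) y / tail Q y) atTop (𝓝 2)) {ε : ℝ} (hε : 0 < ε) :
    ∀ᶠ h in atTop, ∀ᶠ y in atTop,
      (Q.prod Q).real {p | h < p.1 ∧ h < p.2 ∧ y < p.1 + p.2} ≤ ε * tail Q y := by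
  filter_upwards [(tendsto_tail_atTop Q).eventually
    (gt_mem_nhds (show (0 : ℝ) < ε / 4 by positivity))] with h hh
  filter_upwards [eventually_ge_atTop h,
    h2.eventually (gt_mem_nhds (show (2 : ℝ) < 2 + ε / 2 by linarith))] with y hy hlt
  have hbound := tail_conv_ge_of_both_large hQ hy
  have hpos := hpos y
  rw [div_lt_iff₀ hpos] at hlt
  nlinarith

variable {H : Measure ℝ}

theorem tail_positivePart (H : Measure ℝ) {y : ℝ} (hy : 0 ≤ y) :
    tail (positivePart H) y = tail H y := by
  rw [tail, tail, measureReal_def, positivePart_Ioi H hy, measureReal_def]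

theorem Subexponential.tail_positivePart_pos [IsFiniteMeasure H] (hH : Subexponential H) (y : ℝ) :
    0 < tail (positivePart H) y := by
  have : IsFiniteMeasure (positivePart H) := by unfold positivePart; infer_instance
  calc 0 < tail H (max y 0) := hH.1 _
    _ = tail (positivePart H) (max y 0) := (tail_positivePart H (le_max_right y 0)).symm
    _ ≤ tail (positivePart H) y := measureReal_mono (Ioi_subset_Ioi (le_max_left y 0))

theorem Subexponential.measure_Ioi_pos (hH : Subexponential H) (y : ℝ) : 0 < H (Ioi y) :=
  (ENNReal.toReal_pos_iff.1 (hH.1 y)).1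

variable [IsProbabilityMeasure H]

instance : IsProbabilityMeasure (positivePart H) := Measure.isProbabilityMeasure_map (by fun_prop)

theorem Subexponential.tendsto_tail_sub_div_tail (hH : Subexponential H) (h : ℝ) :
    Tendsto (fun y => tail H (y - h) / tail H y) atTop (𝓝 1) := by
  wlog hh : 0 ≤ h generalizing h
  · have hinv := ((this (-h) (by linarith)).comp
      (tendsto_atTop_add_const_right atTop (-h) tendsto_id)).inv₀ one_ne_zero
    refine inv_one (G := ℝ) ▸ hinv.congr fun y => ?_
    simp only [Function.comp_apply, id, inv_div, sub_neg_eq_add,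
      ← sub_eq_add_neg, sub_add_cancel]
  refine (ModulatedWalk.tendsto_tail_sub_div_tail (positivePart_Iio_zero H)
    hH.tail_positivePart_pos hH.2 hh).congr' ?_
  filter_upwards [eventually_ge_atTop h] with y hy
  rw [tail_positivePart H (sub_nonneg.2 hy), tail_positivePart H (hh.trans hy)]

theorem Subexponential.tendsto_measure_Ioi_sub_div (hH : Subexponential H) (h : ℝ) :
    Tendsto (fun y => H (Ioi (y - h)) / H (Ioi y)) atTop (𝓝 1) := by
  refine ENNReal.ofReal_one ▸ (ENNReal.tendsto_ofReal (hH.tendsto_tail_sub_div_tail h)).congr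
    fun y => ?_
  rw [ENNReal.ofReal_div_of_pos (hH.1 y), tail, tail, ofReal_measureReal, ofReal_measureReal]

theorem Subexponential.tendsto_comp_sub_div (hH : Subexponential H) {f : ℝ → ℝ≥0∞} {b : ℝ≥0∞}
    (hf : Tendsto (fun y => f y / H (Ioi y)) atTop (𝓝 b)) (h : ℝ) :
    Tendsto (fun y => f (y - h) / H (Ioi y)) atTop (𝓝 b) := by
  have hshift := hf.comp (tendsto_atTop_add_const_right atTop (-h) tendsto_id)
  refine mul_one b ▸ (ENNReal.Tendsto.mul hshift (.inr ENNReal.one_ne_top)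
    (hH.tendsto_measure_Ioi_sub_div h) (.inl one_ne_zero)).congr fun y => ?_
  simp only [Function.comp_apply, id, ← sub_eq_add_neg]
  rw [← mul_div_assoc, ENNReal.div_mul_cancel (hH.measure_Ioi_pos _).ne' (measure_ne_top _ _)]

-- The sum of two independent copies is large because just one of them is.
theorem Subexponential.eventually_measure_both_large_le (hH : Subexponential H) {ε : ℝ}
    (hε : 0 < ε) : ∀ᶠ h in atTop, ∀ᶠ y in atTop,
      (H.prod H) {p | h < p.1 ∧ h < p.2 ∧ y < p.1 + p.2} ≤ ENNReal.ofReal ε * H (Ioi y) := by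
  filter_upwards [eventually_ge_atTop 0, eventually_measureReal_both_large_le
    (positivePart_Iio_zero H) hH.tail_positivePart_pos hH.2 hε] with h hh hlarge
  filter_upwards [eventually_ge_atTop 0, hlarge] with y hy hle
  have hmeas : MeasurableSet {p : ℝ × ℝ | h < p.1 ∧ h < p.2 ∧ y < p.1 + p.2} := by measurability
  have hprod : (positivePart H).prod (positivePart H) {p | h < p.1 ∧ h < p.2 ∧ y < p.1 + p.2}
      = (H.prod H) {p | h < p.1 ∧ h < p.2 ∧ y < p.1 + p.2} := by
    rw [positivePart, Measure.map_prod_map _ _ (by fun_prop) (by fun_prop),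
      Measure.map_apply (by fun_prop) hmeas]
    congr 1
    ext p
    simp only [mem_preimage, Prod.map_fst, Prod.map_snd, mem_ofPred_eq, lt_max_iff, not_lt.2 hh,
      or_false]
    refine and_congr_right fun h1 => and_congr_right fun h2 => ?_
    rw [max_eq_left (hh.trans h1.le), max_eq_left (hh.trans h2.le)]
  rw [tail_positivePart H hy, measureReal_def, hprod] at hle
  rw [← ofReal_measureReal, ← ofReal_measureReal (μ := H), ← ENNReal.ofReal_mul hε.le]
  exact ENNReal.ofReal_le_ofReal hle

end Subexponential

/-! ### The integrated tail -/

section IntegratedTail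

/-- The integrated tail `∫_y^∞ H̄(t) dt`, not truncated at `1`. -/
noncomputable def intTail (H : Measure ℝ) (y : ℝ) : ℝ≥0∞ := ∫⁻ t in Ioi y, H (Ioi t)

theorem measurable_measure_Ioi (H : Measure ℝ) : Measurable fun t => H (Ioi t) :=
  Antitone.measurable fun _ _ h => measure_mono (Ioi_subset_Ioi h)

theorem intTail_antitone (H : Measure ℝ) : Antitone (intTail H) := fun _ _ h =>
  lintegral_mono_set (Ioi_subset_Ioi h)

theorem intTail_eq_lintegral_Ioc_add (H : Measure ℝ) {x y : ℝ} (hxy : x ≤ y) :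
    intTail H x = (∫⁻ t in Ioc x y, H (Ioi t)) + intTail H y := by
  rw [intTail, ← Ioc_union_Ioi_eq_Ioi hxy, lintegral_union measurableSet_Ioi
    (Set.disjoint_left.2 fun _ h1 h2 => not_lt.2 h1.2 h2), intTail]

theorem ofReal_sub_mul_measure_Ioi_le (H : Measure ℝ) (x y : ℝ) :
    ENNReal.ofReal (y - x) * H (Ioi y) ≤ ∫⁻ t in Ioc x y, H (Ioi t) :=
  calc ENNReal.ofReal (y - x) * H (Ioi y) = ∫⁻ _ in Ioc x y, H (Ioi y) := by
        rw [setLIntegral_const, Real.volume_Ioc, mul_comm]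
    _ ≤ ∫⁻ t in Ioc x y, H (Ioi t) := setLIntegral_mono (measurable_measure_Ioi H) fun _ ht =>
        measure_mono (Ioi_subset_Ioi ht.2)

theorem lintegral_Ioc_measure_Ioi_le (H : Measure ℝ) (x y : ℝ) :
    ∫⁻ t in Ioc x y, H (Ioi t) ≤ ENNReal.ofReal (y - x) * H (Ioi x) :=
  calc ∫⁻ t in Ioc x y, H (Ioi t) ≤ ∫⁻ _ in Ioc x y, H (Ioi x) :=
        setLIntegral_mono measurable_const fun _ ht => measure_mono (Ioi_subset_Ioi ht.1.le)
    _ = ENNReal.ofReal (y - x) * H (Ioi x) := by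
        rw [setLIntegral_const, Real.volume_Ioc, mul_comm]

theorem secondTail_eq (H : Measure ℝ) (y : ℝ) :
    secondTail H y = (min 1 (intTail H y)).toReal := rfl

theorem tendsto_intTail {H : Measure ℝ} (hH : ∃ y, intTail H y ≠ ∞) :
    Tendsto (intTail H) atTop (𝓝 0) := by
  have hdens : ∀ y, volume.withDensity (fun t => H (Ioi t)) (Ioi y) = intTail H y := fun y =>
    withDensity_apply _ measurableSet_Ioi
  simp only [← hdens] at hH
  exact (tendsto_measure_Ioi_atTop hH).congr hdens

variable {F : Measure ℝ} [IsFiniteMeasure F]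

theorem Subexponential.intTail_ne_top (hF : Subexponential (secondTailDist F)) (y : ℝ) :
    intTail F y ≠ ∞ := by
  intro hy
  have htop : ∀ z, intTail F z = ∞ := fun z => by
    rcases le_total z y with hzy | hyz
    · exact top_le_iff.1 (hy ▸ intTail_antitone F hzy)
    · have hIoc : ∫⁻ t in Ioc y z, F (Ioi t) ≠ ∞ := ((lintegral_Ioc_measure_Ioi_le F y z).trans_lt
        (ENNReal.mul_lt_top ENNReal.ofReal_lt_top (measure_lt_top _ _))).ne
      rw [intTail_eq_lintegral_Ioc_add F hyz, ENNReal.add_eq_top] at hy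
      exact hy.resolve_left hIoc
  have hcdf : ∀ z, secondTailCDF F z = 0 := fun z => by
    change 1 - secondTail F z = 0
    rw [secondTail_eq, htop, min_eq_left le_top, ENNReal.toReal_one, sub_self]
  have hzero : secondTailDist F (Ioi 0) = 0 := by
    rw [secondTailDist, (secondTailCDF F).measure_Ioi (l := 0)
      (tendsto_const_nhds.congr fun z => (hcdf z).symm), hcdf, sub_self, ENNReal.ofReal_zero]
  exact (hF.measure_Ioi_pos 0).ne' hzero

theorem Subexponential.tendsto_secondTail (hF : Subexponential (secondTailDist F)) :
    Tendsto (secondTail F) atTop (𝓝 0) := by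
  have h : Tendsto (fun y => min 1 (intTail F y)) atTop (𝓝 (min 1 0)) :=
    tendsto_const_nhds.min (tendsto_intTail ⟨0, hF.intTail_ne_top 0⟩)
  rw [min_eq_right zero_le_one] at h
  exact (ENNReal.tendsto_toReal ENNReal.zero_ne_top).comp h

theorem Subexponential.tendsto_secondTailCDF_atTop (hF : Subexponential (secondTailDist F)) :
    Tendsto (secondTailCDF F) atTop (𝓝 1) := by
  have h := hF.tendsto_secondTail.const_sub 1
  rwa [sub_zero] at h

theorem Subexponential.secondTailDist_Ioi (hF : Subexponential (secondTailDist F)) (y : ℝ) :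
    secondTailDist F (Ioi y) = min 1 (intTail F y) := by
  rw [secondTailDist, (secondTailCDF F).measure_Ioi hF.tendsto_secondTailCDF_atTop]
  change ENNReal.ofReal (1 - (1 - secondTail F y)) = _
  rw [sub_sub_cancel, secondTail_eq, ENNReal.ofReal_toReal (by simp)]

theorem Subexponential.tail_secondTailDist (hF : Subexponential (secondTailDist F)) (y : ℝ) :
    tail (secondTailDist F) y = secondTail F y := by
  rw [tail, measureReal_def, hF.secondTailDist_Ioi, secondTail_eq]

theorem Subexponential.reference_measure_Ioi_pos (hF : Subexponential (secondTailDist F)) (y : ℝ) :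
    0 < F (Ioi y) := by
  refine pos_iff_ne_zero.2 fun hy => (hF.measure_Ioi_pos y).ne' ?_
  have hzero : intTail F y = 0 := by
    rw [intTail, setLIntegral_congr_fun measurableSet_Ioi (g := 0) fun t ht =>
      measure_mono_null (Ioi_subset_Ioi ht.le) hy]
    simp
  rw [hF.secondTailDist_Ioi, hzero, min_eq_right zero_le_one]

theorem Subexponential.exists_one_le_intTail (hF : Subexponential (secondTailDist F)) :
    ∃ y, 1 ≤ intTail F y := by
  have hpos := hF.reference_measure_Ioi_pos 0
  refine ⟨-(F (Ioi 0))⁻¹.toReal, ?_⟩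
  calc 1 = ENNReal.ofReal (0 - -(F (Ioi 0))⁻¹.toReal) * F (Ioi 0) := by
        rw [zero_sub, neg_neg, ENNReal.ofReal_toReal (ENNReal.inv_ne_top.2 hpos.ne'),
          ENNReal.inv_mul_cancel hpos.ne' (measure_ne_top _ _)]
    _ ≤ ∫⁻ t in Ioc _ 0, F (Ioi t) := ofReal_sub_mul_measure_Ioi_le F _ 0
    _ ≤ intTail F _ := lintegral_mono_set Ioc_subset_Ioi_self

theorem Subexponential.isProbabilityMeasure_secondTailDist
    (hF : Subexponential (secondTailDist F)) : IsProbabilityMeasure (secondTailDist F) := by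
  refine (secondTailCDF F).isProbabilityMeasure ?_ hF.tendsto_secondTailCDF_atTop
  obtain ⟨y₀, hy₀⟩ := hF.exists_one_le_intTail
  refine tendsto_const_nhds.congr' ?_
  filter_upwards [eventually_le_atBot y₀] with y hy
  change 0 = 1 - secondTail F y
  rw [secondTail_eq, min_eq_left (hy₀.trans (intTail_antitone F hy)), ENNReal.toReal_one, sub_self]

theorem Subexponential.eventually_secondTailDist_Ioi_eq (hF : Subexponential (secondTailDist F)) :
    ∀ᶠ y in atTop, secondTailDist F (Ioi y) = intTail F y := by
  filter_upwards [(tendsto_intTail ⟨0, hF.intTail_ne_top 0⟩).eventually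
    (gt_mem_nhds zero_lt_one)] with y hy
  rw [hF.secondTailDist_Ioi y, min_eq_right hy.le]

theorem Subexponential.tendsto_reference_measure_Ioi_div
    (hF : Subexponential (secondTailDist F)) :
    Tendsto (fun y => F (Ioi y) / secondTailDist F (Ioi y)) atTop (𝓝 0) := by
  have := hF.isProbabilityMeasure_secondTailDist
  have hlong := ENNReal.Tendsto.sub (hF.tendsto_measure_Ioi_sub_div 1)
    (tendsto_const_nhds (x := (1 : ℝ≥0∞))) (.inl ENNReal.one_ne_top)
  rw [tsub_self] at hlong
  refine tendsto_of_tendsto_of_tendsto_of_le_of_le' tendsto_const_nhds hlong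
    (Eventually.of_forall fun _ => zero_le) ?_
  filter_upwards [hF.eventually_secondTailDist_Ioi_eq,
    (tendsto_atTop_add_const_right atTop (-1) tendsto_id).eventually
      hF.eventually_secondTailDist_Ioi_eq] with y hy hy1
  rw [id, ← sub_eq_add_neg] at hy1
  have hpos := (hF.measure_Ioi_pos y).ne'
  have hincr : F (Ioi y) + secondTailDist F (Ioi y) ≤ secondTailDist F (Ioi (y - 1)) := by
    rw [hy, hy1, intTail_eq_lintegral_Ioc_add F (sub_le_self y zero_le_one)]
    gcongr
    simpa using ofReal_sub_mul_measure_Ioi_le F (y - 1) y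
  refine ENNReal.le_sub_of_add_le_right ENNReal.one_ne_top ?_
  rw [← ENNReal.div_self hpos (measure_ne_top _ _), ← ENNReal.add_div]
  gcongr

theorem Subexponential.tendsto_intTail_sub_div (hF : Subexponential (secondTailDist F)) (h : ℝ) :
    Tendsto (fun y => intTail F (y - h) / secondTailDist F (Ioi y)) atTop (𝓝 1) := by
  have := hF.isProbabilityMeasure_secondTailDist
  refine hF.tendsto_comp_sub_div (tendsto_const_nhds.congr' ?_) h
  filter_upwards [hF.eventually_secondTailDist_Ioi_eq] with y hy
  rw [← hy, ENNReal.div_self (hF.measure_Ioi_pos y).ne' (measure_ne_top _ _)]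

end IntegratedTail

/-! ### Sums of tails along arithmetic progressions -/

section TailSums

theorem intTail_eq_tsum (H : Measure ℝ) {α : ℝ} (hα : 0 < α) (w : ℝ) :
    intTail H w = ∑' n : ℕ, ∫⁻ t in Ioc (w + α * n) (w + α * (n + 1)), H (Ioi t) := by
  have hmono : Monotone fun n : ℕ => w + α * n := fun m n h => by
    have : (m : ℝ) ≤ n := Nat.cast_le.2 h
    dsimp only
    gcongr
  have htop : Tendsto (fun n : ℕ => w + α * n) atTop atTop :=
    tendsto_atTop_add_const_left _ _ (tendsto_natCast_atTop_atTop.const_mul_atTop hα)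
  have hunion : ⋃ n : ℕ, Ioc (w + α * n) (w + α * (Order.succ n : ℕ)) = Ioi w := by
    rw [iUnion_Ioc_map_succ_eq_Ioi (f := fun n : ℕ => w + α * n) (fun _ => hmono bot_le)
      (not_bddAbove_of_tendsto_atTop htop)]
    simp
  rw [intTail, ← hunion, lintegral_iUnion (fun n => measurableSet_Ioc)
    hmono.pairwise_disjoint_on_Ioc_succ]
  simp

theorem ofReal_mul_tsum_measure_Ioi_le (H : Measure ℝ) {α : ℝ} (hα : 0 < α) (w : ℝ) :
    ENNReal.ofReal α * ∑' n : ℕ, H (Ioi (w + α * (n + 1))) ≤ intTail H w := by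
  rw [intTail_eq_tsum H hα, ← ENNReal.tsum_mul_left]
  refine ENNReal.tsum_le_tsum fun n => ?_
  convert ofReal_sub_mul_measure_Ioi_le H (w + α * n) (w + α * (n + 1)) using 3
  ring

theorem intTail_le_ofReal_mul_tsum (H : Measure ℝ) {α : ℝ} (hα : 0 < α) (w : ℝ) :
    intTail H w ≤ ENNReal.ofReal α * ∑' n : ℕ, H (Ioi (w + α * n)) := by
  rw [intTail_eq_tsum H hα, ← ENNReal.tsum_mul_left]
  refine ENNReal.tsum_le_tsum fun n => ?_
  convert lintegral_Ioc_measure_Ioi_le H (w + α * n) (w + α * (n + 1)) using 3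
  ring

end TailSums

/-! ### Total variation -/

section TotalVariation

variable {E : Type*} [MeasurableSpace E]

theorem tvDist_comm (μ ν : Measure E) : tvDist μ ν = tvDist ν μ := by
  simp only [tvDist, abs_sub_comm]

theorem bddAbove_range_abs_sub (μ ν : Measure E) [IsFiniteMeasure μ] [IsFiniteMeasure ν] :
    BddAbove (range fun B : {B : Set E // MeasurableSet B} => |μ.real B - ν.real B|) := by
  refine ⟨μ.real univ + ν.real univ, ?_⟩
  rintro _ ⟨B, rfl⟩
  refine (abs_sub _ _).trans ?_
  rw [abs_of_nonneg measureReal_nonneg, abs_of_nonneg measureReal_nonneg]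
  exact add_le_add (measureReal_mono (subset_univ _)) (measureReal_mono (subset_univ _))

variable {μ ν : Measure E} [IsFiniteMeasure μ] [IsFiniteMeasure ν]

theorem measure_sub_le_tvDist {B : Set E} (hB : MeasurableSet B) :
    μ B - ν B ≤ ENNReal.ofReal (tvDist μ ν) := by
  rw [← ofReal_measureReal (μ := μ), ← ofReal_measureReal (μ := ν),
    ← ENNReal.ofReal_sub _ measureReal_nonneg]
  exact ENNReal.ofReal_le_ofReal
    ((le_abs_self _).trans (le_ciSup (bddAbove_range_abs_sub μ ν) ⟨B, hB⟩))

theorem lintegral_le_lintegral_add_tvDist {f : E → ℝ≥0∞} {K : ℝ≥0∞} (hf : ∀ x, f x ≤ K) :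
    ∫⁻ x, f x ∂μ ≤ ∫⁻ x, f x ∂ν + K * ENNReal.ofReal (tvDist μ ν) := by
  obtain ⟨s, hs⟩ := exists_isHahnDecomposition μ ν
  have hexcess : ∫⁻ x, f x ∂(μ.restrict sᶜ - ν.restrict sᶜ)
      ≤ K * ENNReal.ofReal (tvDist μ ν) := by
    calc ∫⁻ x, f x ∂(μ.restrict sᶜ - ν.restrict sᶜ)
        ≤ ∫⁻ _, K ∂(μ.restrict sᶜ - ν.restrict sᶜ) := lintegral_mono hf
      _ = K * (μ sᶜ - ν sᶜ) := by
          rw [lintegral_const, Measure.sub_apply MeasurableSet.univ hs.ge_on_compl,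
            Measure.restrict_apply_univ, Measure.restrict_apply_univ]
      _ ≤ K * ENNReal.ofReal (tvDist μ ν) := by
          gcongr
          exact measure_sub_le_tvDist hs.measurableSet.compl
  calc ∫⁻ x, f x ∂μ
      = ∫⁻ x in s, f x ∂μ + ∫⁻ x in sᶜ, f x ∂μ := (lintegral_add_compl f hs.measurableSet).symm
    _ = ∫⁻ x in s, f x ∂μ + (∫⁻ x, f x ∂(μ.restrict sᶜ - ν.restrict sᶜ) + ∫⁻ x in sᶜ, f x ∂ν) := by
        rw [← lintegral_add_measure f (_ - _), Measure.sub_add_cancel_of_le hs.ge_on_compl]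
    _ ≤ ∫⁻ x in s, f x ∂ν + (K * ENNReal.ofReal (tvDist μ ν) + ∫⁻ x in sᶜ, f x ∂ν) :=
        add_le_add (lintegral_mono' hs.le_on le_rfl) (add_le_add hexcess le_rfl)
    _ = ∫⁻ x, f x ∂ν + K * ENNReal.ofReal (tvDist μ ν) := by
        rw [add_left_comm, lintegral_add_compl f hs.measurableSet, add_comm]

theorem tendsto_lintegral_of_tendsto_tvDist {ι κ : Type*} {l : Filter ι} {l' : Filter κ}
    {μ : ι → Measure E} [∀ i, IsFiniteMeasure (μ i)]
    (htv : Tendsto (fun i => tvDist (μ i) ν) l (𝓝 0)) {f : κ → E → ℝ≥0∞} {K I : ℝ≥0∞} (hK : K ≠ ∞)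
    (hf : ∀ z x, f z x ≤ K) (hI : Tendsto (fun z => ∫⁻ x, f z x ∂ν) l' (𝓝 I)) :
    Tendsto (fun p : ι × κ => ∫⁻ x, f p.2 x ∂μ p.1) (l ×ˢ l') (𝓝 I) := by
  have herr : Tendsto (fun p : ι × κ => K * ENNReal.ofReal (tvDist (μ p.1) ν)) (l ×ˢ l') (𝓝 0) := by
    have h := ENNReal.Tendsto.const_mul (ENNReal.tendsto_ofReal htv) (.inr hK)
    rw [ENNReal.ofReal_zero, mul_zero] at h
    exact h.comp tendsto_fst
  have hmain : Tendsto (fun p : ι × κ => ∫⁻ x, f p.2 x ∂ν) (l ×ˢ l') (𝓝 I) := hI.comp tendsto_snd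
  refine tendsto_of_tendsto_of_tendsto_of_le_of_le
    (tsub_zero I ▸ ENNReal.Tendsto.sub hmain herr (.inr ENNReal.zero_ne_top))
    (add_zero I ▸ hmain.add herr) (fun p => ?_)
    fun p => lintegral_le_lintegral_add_tvDist (hf p.2)
  rw [tvDist_comm]
  exact tsub_le_iff_right.2 (lintegral_le_lintegral_add_tvDist (hf p.2))

end TotalVariation

/-! ### The expected number of big jumps -/

section TailSums

variable {H : Measure ℝ} {g : ℕ → ℝ → ℝ≥0∞} {d N : ℕ} {α z₀ w : ℝ} {b K : ℝ≥0∞}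

theorem tsum_eq_sum_range_add_tsum_sum_range (u : ℕ → ℝ≥0∞) (hd : 0 < d) (N : ℕ) :
    ∑' n, u n = ∑ i ∈ Finset.range N, u i + ∑' k, ∑ j ∈ Finset.range d, u (N + d * k + j) := by
  have : NeZero d := ⟨hd.ne'⟩
  rw [← Summable.sum_add_tsum_nat_add' (k := N) ENNReal.summable]
  congr 1
  rw [← (Nat.divModEquiv d).symm.tsum_eq, ENNReal.tsum_prod']
  refine tsum_congr fun k => ?_
  rw [tsum_fintype, Finset.sum_range]
  refine Finset.sum_congr rfl fun j _ => congrArg u ?_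
  rw [Nat.divModEquiv_symm_apply]
  ring

theorem mul_mul_tsum_le_intTail (hd : 0 < d) (hα : 0 < α) :
    b * (d * ∑' k : ℕ, H (Ioi (w + α * d * (k + 1)))) ≤ b / ENNReal.ofReal α * intTail H w := by
  have h0 : ENNReal.ofReal α ≠ 0 := (ENNReal.ofReal_pos.2 hα).ne'
  calc b * (d * ∑' k : ℕ, H (Ioi (w + α * d * (k + 1))))
      = b / ENNReal.ofReal α
          * (ENNReal.ofReal (α * d) * ∑' k : ℕ, H (Ioi (w + α * d * (k + 1)))) := by
        rw [ENNReal.ofReal_mul hα.le, ENNReal.ofReal_natCast, mul_assoc, ← mul_assoc (b / _),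
          ENNReal.div_mul_cancel h0 ENNReal.ofReal_ne_top]
    _ ≤ b / ENNReal.ofReal α * intTail H w := by
        gcongr
        exact ofReal_mul_tsum_measure_Ioi_le H (mul_pos hα (Nat.cast_pos.2 hd)) w

theorem tsum_le_of_sum_range_le (hg : ∀ n, Antitone (g n)) (hK : ∀ n z, g n z ≤ K * H (Ioi z))
    (hd : 0 < d) (hα : 0 < α)
    (hblock : ∀ n ≥ N, ∀ z ≥ z₀, ∑ j ∈ Finset.range d, g (n + j) z ≤ b * (d * H (Ioi z)))
    (hw : z₀ ≤ w) :
    ∑' n : ℕ, g (n + 1) (w + α * (n + 1))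
      ≤ b / ENNReal.ofReal α * intTail H w + (N * K + b * d) * H (Ioi w) := by
  have hinit : ∑ i ∈ Finset.range N, g (i + 1) (w + α * (i + 1)) ≤ N * K * H (Ioi w) := by
    calc ∑ i ∈ Finset.range N, g (i + 1) (w + α * (i + 1))
        ≤ ∑ _i ∈ Finset.range N, K * H (Ioi w) := Finset.sum_le_sum fun _ _ =>
          (hg _ (le_add_of_nonneg_right (by positivity))).trans (hK _ w)
      _ = N * K * H (Ioi w) := by rw [Finset.sum_const, Finset.card_range, nsmul_eq_mul, mul_assoc]
  have hrest (k : ℕ) : ∑ j ∈ Finset.range d,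
      g (N + d * k + j + 1) (w + α * ((N + d * k + j : ℕ) + 1))
        ≤ b * (d * H (Ioi (w + α * d * k))) := by
    refine (Finset.sum_le_sum fun j _ => ?_).trans
      (hblock (N + d * k + 1) (by lia) (w + α * d * k) (hw.trans ?_))
    · rw [add_right_comm]
      refine hg _ ?_
      push_cast
      nlinarith [mul_nonneg hα.le (Nat.cast_nonneg (α := ℝ) N),
        mul_nonneg hα.le (Nat.cast_nonneg (α := ℝ) j)]
    · exact le_add_of_nonneg_right (by positivity)
  have hblocks : ∑' k : ℕ, b * (d * H (Ioi (w + α * d * k)))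
      ≤ b * (d * H (Ioi w)) + b / ENNReal.ofReal α * intTail H w := by
    rw [ENNReal.tsum_mul_left, ENNReal.tsum_mul_left, tsum_eq_zero_add' ENNReal.summable, mul_add,
      mul_add]
    push_cast
    rw [mul_zero, add_zero]
    exact add_le_add le_rfl (mul_mul_tsum_le_intTail hd hα)
  rw [tsum_eq_sum_range_add_tsum_sum_range _ hd N]
  refine (add_le_add hinit ((ENNReal.tsum_le_tsum hrest).trans hblocks)).trans_eq ?_
  ring

theorem le_tsum_of_le_sum_range (hg : ∀ n, Antitone (g n)) (hd : 0 < d) (hα : 0 < α)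
    (hblock : ∀ n ≥ N, ∀ z ≥ z₀, b * (d * H (Ioi z)) ≤ ∑ j ∈ Finset.range d, g (n + j) z)
    (hw : z₀ ≤ w) :
    b / ENNReal.ofReal α * intTail H (w + α * (N + d))
      ≤ ∑' n : ℕ, g (n + 1) (w + α * (n + 1)) := by
  have hdα : 0 < α * d := mul_pos hα (Nat.cast_pos.2 hd)
  have h0 : ENNReal.ofReal α ≠ 0 := (ENNReal.ofReal_pos.2 hα).ne'
  have hrest (k : ℕ) : b * (d * H (Ioi (w + α * (N + d) + α * d * k)))
      ≤ ∑ j ∈ Finset.range d, g (N + d * k + j + 1) (w + α * ((N + d * k + j : ℕ) + 1)) := by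
    refine (hblock (N + d * k + 1) (by lia) _ (hw.trans ?_)).trans
      (Finset.sum_le_sum fun j hj => ?_)
    · rw [add_assoc]
      exact le_add_of_nonneg_right (by positivity)
    · have hj : ((j : ℝ) + 1) ≤ d := by exact_mod_cast Finset.mem_range.1 hj
      rw [add_right_comm]
      refine hg _ ?_
      push_cast
      nlinarith
  calc b / ENNReal.ofReal α * intTail H (w + α * (N + d))
      ≤ b / ENNReal.ofReal α
          * (ENNReal.ofReal (α * d) * ∑' k : ℕ, H (Ioi (w + α * (N + d) + α * d * k))) := by
        gcongr
        exact intTail_le_ofReal_mul_tsum H hdα _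
    _ = ∑' k : ℕ, b * (d * H (Ioi (w + α * (N + d) + α * d * k))) := by
        rw [ENNReal.ofReal_mul hα.le, ENNReal.ofReal_natCast, mul_assoc, ← mul_assoc (b / _),
          ENNReal.div_mul_cancel h0 ENNReal.ofReal_ne_top, ENNReal.tsum_mul_left,
          ENNReal.tsum_mul_left]
    _ ≤ ∑' k : ℕ, ∑ j ∈ Finset.range d,
          g (N + d * k + j + 1) (w + α * ((N + d * k + j : ℕ) + 1)) := ENNReal.tsum_le_tsum hrest
    _ ≤ ∑' n : ℕ, g (n + 1) (w + α * (n + 1)) := by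
        rw [tsum_eq_sum_range_add_tsum_sum_range (fun n => g (n + 1) (w + α * (n + 1))) hd N]
        exact le_add_self

end TailSums

section JumpSum

variable {E Ω : Type*} [MeasurableSpace E] [MeasurableSpace Ω]

/-- The probability that `X n ∈ B` and that the increment at time `n`, which has law `P (X n)`,
exceeds `z`. -/
noncomputable def jumpProb (Pr : Measure Ω) (P : Kernel E ℝ) (X : ℕ → Ω → E) (B : Set E) (n : ℕ)
    (z : ℝ) : ℝ≥0∞ :=
  ∫⁻ ω in X n ⁻¹' B, P (X n ω) (Ioi z) ∂Pr

/-- The expected number of times `n ≥ 1` at which `X n ∈ B` and the increment exceeds `w + α n`. -/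
noncomputable def jumpSum (Pr : Measure Ω) (P : Kernel E ℝ) (X : ℕ → Ω → E) (B : Set E) (α w : ℝ) :
    ℝ≥0∞ :=
  ∑' n : ℕ, jumpProb Pr P X B (n + 1) (w + α * (n + 1))

variable {Pr : Measure Ω} {P : Kernel E ℝ} {X : ℕ → Ω → E} {B : Set E} {F : Measure ℝ} {L : ℝ≥0∞}

theorem jumpProb_antitone (n : ℕ) : Antitone (jumpProb Pr P X B n) := fun _ _ h =>
  lintegral_mono fun _ => measure_mono (Ioi_subset_Ioi h)

theorem jumpProb_le [IsProbabilityMeasure Pr] (hL : ∀ x y, P x (Ioi y) ≤ L * F (Ioi y)) (n : ℕ)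
    (z : ℝ) : jumpProb Pr P X B n z ≤ L * F (Ioi z) :=
  calc jumpProb Pr P X B n z ≤ ∫⁻ _, L * F (Ioi z) ∂Pr :=
        (lintegral_mono fun _ => hL _ _).trans (setLIntegral_le_lintegral _ _)
    _ = L * F (Ioi z) := by rw [lintegral_const, measure_univ, mul_one]

theorem jumpProb_eq_setLIntegral_map (hB : MeasurableSet B) {n : ℕ} (hX : Measurable (X n))
    (z : ℝ) :
    jumpProb Pr P X B n z = ∫⁻ x in B, P x (Ioi z) ∂Pr.map (X n) :=
  (setLIntegral_map hB (P.measurable_coe measurableSet_Ioi) hX).symm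

theorem tendsto_setLIntegral_tail_div {π : Measure E} [IsFiniteMeasure π] (hLtop : L ≠ ∞)
    (hL : ∀ x y, P x (Ioi y) ≤ L * F (Ioi y)) {γ : E → ℝ≥0∞}
    (hγ : ∀ x, Tendsto (fun z => P x (Ioi z) / F (Ioi z)) atTop (𝓝 (γ x))) :
    Tendsto (fun z => ∫⁻ x in B, P x (Ioi z) / F (Ioi z) ∂π) atTop (𝓝 (∫⁻ x in B, γ x ∂π)) := by
  refine tendsto_lintegral_filter_of_dominated_convergence (fun _ => L)
    (.of_forall fun z => (P.measurable_coe measurableSet_Ioi).div_const _)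
    (.of_forall fun z => .of_forall fun x => ENNReal.div_le_of_le_mul (hL x z)) ?_
    (.of_forall hγ)
  rw [lintegral_const]
  exact ENNReal.mul_ne_top hLtop (measure_ne_top _ _)

theorem sum_jumpProb_div (hX : ∀ n, 1 ≤ n → Measurable (X n)) (hB : MeasurableSet B) {n : ℕ}
    (hn : 1 ≤ n) {d : ℕ} (hd : 0 < d) (z : ℝ) :
    (∑ j ∈ Finset.range d, jumpProb Pr P X B (n + j) z) / (d * F (Ioi z))
      = ∫⁻ x in B, P x (Ioi z) / F (Ioi z)
          ∂((d : ℝ≥0∞)⁻¹ • ∑ j ∈ Finset.range d, Pr.map (X (n + j))) := by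
  simp only [fun j => jumpProb_eq_setLIntegral_map (P := P) (Pr := Pr) hB
    (hX (n + j) (Nat.le_add_right_of_le hn)) z, div_eq_mul_inv]
  rw [lintegral_mul_const _ (P.measurable_coe measurableSet_Ioi), ← lintegral_indicator hB,
    lintegral_smul_measure, lintegral_finsetSum_measure,
    ENNReal.mul_inv (.inl (Nat.cast_ne_zero.2 hd.ne')) (.inl (ENNReal.natCast_ne_top d)),
    smul_eq_mul]
  simp only [lintegral_indicator hB]
  ring

theorem eventually_lt_jumpSum_div [IsFiniteMeasure F] (hF : Subexponential (secondTailDist F))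
    {d : ℕ} (hd : 0 < d) {α : ℝ} (hα : 0 < α) {C l : ℝ≥0∞}
    (hblock : Tendsto (fun p : ℕ × ℝ =>
        (∑ j ∈ Finset.range d, jumpProb Pr P X B (p.1 + j) p.2) / (d * F (Ioi p.2)))
      (atTop ×ˢ atTop) (𝓝 C)) (hl : l < C / ENNReal.ofReal α) :
    ∀ᶠ y in atTop, l < jumpSum Pr P X B α y / secondTailDist F (Ioi y) := by
  have hα0 : ENNReal.ofReal α ≠ 0 := (ENNReal.ofReal_pos.2 hα).ne'
  obtain ⟨b, hb, hbC⟩ := exists_between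
    ((ENNReal.lt_div_iff_mul_lt (.inl hα0) (.inl ENNReal.ofReal_ne_top)).1 hl)
  obtain ⟨⟨N, z₀⟩, hN⟩ := eventually_atTop.1 (prod_atTop_atTop_eq (α := ℕ) (β := ℝ) ▸
    hblock.eventually (lt_mem_nhds hbC))
  have hsum (y : ℝ) (hy : z₀ ≤ y) :
      b / ENNReal.ofReal α * intTail F (y + α * (N + d)) ≤ jumpSum Pr P X B α y :=
    le_tsum_of_le_sum_range jumpProb_antitone hd hα (fun n hn z hz =>
      ENNReal.mul_le_of_le_div (hN (n, z) ⟨hn, hz⟩).le) hy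
  have hlim := ENNReal.Tendsto.const_mul (a := b / ENNReal.ofReal α)
    (hF.tendsto_intTail_sub_div (-(α * (N + d)))) (.inl one_ne_zero)
  simp only [sub_neg_eq_add, mul_one] at hlim
  filter_upwards [eventually_ge_atTop z₀, hlim.eventually (lt_mem_nhds
    ((ENNReal.lt_div_iff_mul_lt (.inl hα0) (.inl ENNReal.ofReal_ne_top)).2 hb))] with y hy hlt
  rw [← mul_div_assoc] at hlt
  exact hlt.trans_le (ENNReal.div_le_div_right (hsum y hy) _)

variable [IsProbabilityMeasure Pr] {π : Measure E} [IsFiniteMeasure π] {d : ℕ} {γ : E → ℝ≥0∞}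

theorem tendsto_sum_jumpProb_div (hX : ∀ n, 1 ≤ n → Measurable (X n)) (hB : MeasurableSet B)
    (hLtop : L ≠ ∞) (hL : ∀ x y, P x (Ioi y) ≤ L * F (Ioi y))
    (hγ : ∀ x, Tendsto (fun z => P x (Ioi z) / F (Ioi z)) atTop (𝓝 (γ x))) (hd : 0 < d)
    (hC1 : ConvergesInMean Pr X d π) :
    Tendsto (fun p : ℕ × ℝ =>
        (∑ j ∈ Finset.range d, jumpProb Pr P X B (p.1 + j) p.2) / (d * F (Ioi p.2)))
      (atTop ×ˢ atTop) (𝓝 (∫⁻ x in B, γ x ∂π)) := by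
  have (n : ℕ) : IsFiniteMeasure
      ((d : ℝ≥0∞)⁻¹ • ∑ j ∈ Finset.range d, Pr.map (X (n + j))) :=
    Measure.smul_finite _ (ENNReal.inv_ne_top.2 (Nat.cast_ne_zero.2 hd.ne'))
  have hbound (z : ℝ) (x : E) : B.indicator (fun x => P x (Ioi z) / F (Ioi z)) x ≤ L :=
    indicator_apply_le' (fun _ => ENNReal.div_le_of_le_mul (hL x z)) fun _ => zero_le
  have hlim := tendsto_setLIntegral_tail_div (B := B) (π := π) hLtop hL hγ
  rw [← lintegral_indicator hB] at hlim
  simp only [← lintegral_indicator hB] at hlim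
  rw [← lintegral_indicator hB]
  refine (tendsto_lintegral_of_tendsto_tvDist hC1 hLtop hbound hlim).congr' ?_
  filter_upwards [tendsto_fst.eventually (eventually_ge_atTop 1)] with p hp
  rw [lintegral_indicator hB, sum_jumpProb_div hX hB hp hd]

variable [IsFiniteMeasure F]

theorem eventually_jumpSum_div_lt (hF : Subexponential (secondTailDist F))
    (hLtop : L ≠ ∞) (hL : ∀ x y, P x (Ioi y) ≤ L * F (Ioi y)) (hd : 0 < d) {α : ℝ} (hα : 0 < α)
    {C u : ℝ≥0∞}
    (hblock : Tendsto (fun p : ℕ × ℝ =>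
        (∑ j ∈ Finset.range d, jumpProb Pr P X B (p.1 + j) p.2) / (d * F (Ioi p.2)))
      (atTop ×ˢ atTop) (𝓝 C)) (hu : C / ENNReal.ofReal α < u) :
    ∀ᶠ y in atTop, jumpSum Pr P X B α y / secondTailDist F (Ioi y) < u := by
  have hα0 : ENNReal.ofReal α ≠ 0 := (ENNReal.ofReal_pos.2 hα).ne'
  obtain ⟨b, hCb, hb⟩ := exists_between
    ((ENNReal.div_lt_iff (.inl hα0) (.inl ENNReal.ofReal_ne_top)).1 hu)
  obtain ⟨⟨N, z₀⟩, hN⟩ := eventually_atTop.1 (prod_atTop_atTop_eq (α := ℕ) (β := ℝ) ▸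
    hblock.eventually (gt_mem_nhds hCb))
  have hd0 : (d : ℝ≥0∞) ≠ 0 := Nat.cast_ne_zero.2 hd.ne'
  have hsum (y : ℝ) (hy : z₀ ≤ y) : jumpSum Pr P X B α y
      ≤ b / ENNReal.ofReal α * intTail F y + (N * L + b * d) * F (Ioi y) := by
    refine tsum_le_of_sum_range_le jumpProb_antitone (jumpProb_le hL) hd hα (fun n hn z hz => ?_) hy
    refine (ENNReal.div_le_iff ?_ (ENNReal.mul_ne_top (by simp) (measure_ne_top _ _))).1
      (hN (n, z) ⟨hn, hz⟩).le
    exact mul_ne_zero hd0 (hF.reference_measure_Ioi_pos z).ne'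
  have hlim : Tendsto (fun y => b / ENNReal.ofReal α
        * (intTail F y / secondTailDist F (Ioi y))
      + (N * L + b * d) * (F (Ioi y) / secondTailDist F (Ioi y))) atTop
      (𝓝 (b / ENNReal.ofReal α * 1 + (N * L + b * d) * 0)) := by
    refine (ENNReal.Tendsto.const_mul ?_ (.inl one_ne_zero)).add
      (ENNReal.Tendsto.const_mul hF.tendsto_reference_measure_Ioi_div (.inr ?_))
    · simpa only [sub_zero] using hF.tendsto_intTail_sub_div 0
    · finiteness
  rw [mul_one, mul_zero, add_zero] at hlim
  filter_upwards [eventually_ge_atTop z₀, hlim.eventually (gt_mem_nhds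
    (ENNReal.div_lt_of_lt_mul hb))] with y hy hlt
  refine (ENNReal.div_le_div_right (hsum y hy) _).trans_lt ?_
  rwa [ENNReal.add_div, mul_div_assoc, mul_div_assoc]

theorem tendsto_jumpSum_div (hF : Subexponential (secondTailDist F))
    (hX : ∀ n, 1 ≤ n → Measurable (X n)) (hB : MeasurableSet B)
    (hLtop : L ≠ ∞) (hL : ∀ x y, P x (Ioi y) ≤ L * F (Ioi y))
    (hγ : ∀ x, Tendsto (fun z => P x (Ioi z) / F (Ioi z)) atTop (𝓝 (γ x))) (hd : 0 < d)
    (hC1 : ConvergesInMean Pr X d π) {α : ℝ} (hα : 0 < α) :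
    Tendsto (fun y => jumpSum Pr P X B α y / secondTailDist F (Ioi y)) atTop
      (𝓝 ((∫⁻ x in B, γ x ∂π) / ENNReal.ofReal α)) := by
  have hblock := tendsto_sum_jumpProb_div (π := π) hX hB hLtop hL hγ hd hC1
  exact tendsto_order.2 ⟨fun _ hl => eventually_lt_jumpSum_div hF hd hα hblock hl,
    fun _ hu => eventually_jumpSum_div_lt hF hLtop hL hd hα hblock hu⟩

end JumpSum

section Independence

variable {Ω : Type*} {mΩ : MeasurableSpace Ω} {μ : Measure Ω}

theorem sup_eq_generateFrom_inter (m₁ m₂ : MeasurableSpace Ω) :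
    m₁ ⊔ m₂ = MeasurableSpace.generateFrom
      {u | ∃ s t, MeasurableSet[m₁] s ∧ MeasurableSet[m₂] t ∧ u = s ∩ t} := by
  refine le_antisymm (sup_le (fun s hs => ?_) fun t ht => ?_) (MeasurableSpace.generateFrom_le ?_)
  · exact MeasurableSpace.measurableSet_generateFrom
      ⟨s, univ, hs, MeasurableSet.univ, (inter_univ s).symm⟩
  · exact MeasurableSpace.measurableSet_generateFrom
      ⟨univ, t, MeasurableSet.univ, ht, (univ_inter t).symm⟩
  · rintro _ ⟨s, t, hs, ht, rfl⟩
    exact MeasurableSet.inter ((le_sup_left : m₁ ≤ m₁ ⊔ m₂) s hs)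
      ((le_sup_right : m₂ ≤ m₁ ⊔ m₂) t ht)

theorem indep_sup_left_of_indep_sup [IsZeroOrProbabilityMeasure μ] {m₁ m₂ m₃ : MeasurableSpace Ω}
    (h₁ : m₁ ≤ mΩ) (h₂ : m₂ ≤ mΩ) (h₃ : m₃ ≤ mΩ) (h₁₂ : Indep m₁ m₂ μ)
    (h : Indep (m₁ ⊔ m₂) m₃ μ) : Indep (m₁ ⊔ m₃) m₂ μ := by
  refine IndepSets.indep (sup_le h₁ h₃) h₂ ?_ (@MeasurableSpace.isPiSystem_measurableSet Ω m₂)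
    (sup_eq_generateFrom_inter m₁ m₃) (@MeasurableSpace.generateFrom_measurableSet Ω m₂).symm ?_
  · rintro _ ⟨s, t, hs, ht, rfl⟩ _ ⟨s', t', hs', ht', rfl⟩ -
    exact ⟨s ∩ s', t ∩ t', hs.inter hs', ht.inter ht', inter_inter_inter_comm ..⟩
  · rw [IndepSets_iff]
    rintro _ v ⟨s, t, hs, ht, rfl⟩ hv
    rw [Indep_iff] at h h₁₂
    have hs' : MeasurableSet[m₁ ⊔ m₂] s := (le_sup_left : m₁ ≤ m₁ ⊔ m₂) s hs
    have hv' : MeasurableSet[m₁ ⊔ m₂] v := (le_sup_right : m₂ ≤ m₁ ⊔ m₂) v hv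
    rw [h s t hs' ht, inter_right_comm, h _ t (hs'.inter hv') ht, h₁₂ s v hs hv]
    ring

theorem lintegral_comp_of_indepFun [IsFiniteMeasure μ] {α β : Type*} [MeasurableSpace α]
    [MeasurableSpace β] {U : Ω → α} {V : Ω → β} (hU : Measurable U) (hV : Measurable V)
    (h : IndepFun U V μ) {φ : α × β → ℝ≥0∞} (hφ : Measurable φ) :
    ∫⁻ ω, φ (U ω, V ω) ∂μ = ∫⁻ ω, ∫⁻ ω', φ (U ω, V ω') ∂μ ∂μ := by
  rw [← lintegral_map hφ (hU.prodMk hV),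
    (indepFun_iff_map_prod_eq_prod_map_map hU.aemeasurable hV.aemeasurable).1 h,
    lintegral_prod _ hφ.aemeasurable, lintegral_map hφ.lintegral_prod_right' hU]
  exact lintegral_congr fun ω => lintegral_map (hφ.comp measurable_prodMk_left) hV

theorem lintegral_diag_of_indep [IsFiniteMeasure μ] {m₁ m₂ : MeasurableSpace Ω} (h₁ : m₁ ≤ mΩ)
    (h₂ : m₂ ≤ mΩ) (h : Indep m₁ m₂ μ) {φ : Ω × Ω → ℝ≥0∞} (hφ : Measurable[m₁.prod m₂] φ) :
    ∫⁻ ω, φ (ω, ω) ∂μ = ∫⁻ ω, ∫⁻ ω', φ (ω, ω') ∂μ ∂μ := by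
  refine @lintegral_comp_of_indepFun Ω mΩ μ _ Ω Ω m₁ m₂ id id h₁ h₂ ?_ φ hφ
  rw [@IndepFun_iff_Indep, @MeasurableSpace.comap_id _ m₁, @MeasurableSpace.comap_id _ m₂]
  exact h

theorem setLIntegral_diag_of_indep [IsFiniteMeasure μ] {m₁ m₂ : MeasurableSpace Ω}
    (h₁ : m₁ ≤ mΩ) (h₂ : m₂ ≤ mΩ) (h : Indep m₁ m₂ μ) {A : Set Ω} (hA : MeasurableSet[m₁] A)
    {φ : Ω × Ω → ℝ≥0∞} (hφ : Measurable[m₁.prod m₂] φ) :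
    ∫⁻ ω in A, φ (ω, ω) ∂μ = ∫⁻ ω in A, ∫⁻ ω', φ (ω, ω') ∂μ ∂μ := by
  have hAφ : Measurable[m₁.prod m₂] ((A ×ˢ univ).indicator φ) :=
    hφ.indicator (hA.prod MeasurableSet.univ)
  have hdiag := lintegral_diag_of_indep h₁ h₂ h hAφ
  rw [← lintegral_indicator (h₁ A hA), ← lintegral_indicator (h₁ A hA)]
  refine (lintegral_congr fun ω => ?_).trans (hdiag.trans (lintegral_congr fun ω => ?_)) <;>
    by_cases hω : ω ∈ A <;> simp [hω]

end Independence

section History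

variable {E Ω : Type*} [mE : MeasurableSpace E]

/-- The `σ`-algebra generated by the modulating process. -/
abbrev modulationAlgebra (X : ℕ → Ω → E) : MeasurableSpace Ω := ⨆ n : ℕ+, mE.comap (X n)

/-- The `σ`-algebra generated by the first `N` of the `σ`-algebras `𝒢 n` together with the
modulating process. -/
abbrev historyAlgebra (𝒢 : ℕ+ → MeasurableSpace Ω) (X : ℕ → Ω → E) (N : ℕ) : MeasurableSpace Ω :=
  (⨆ n ∈ {n : ℕ+ | (n : ℕ) ≤ N}, 𝒢 n) ⊔ modulationAlgebra X

variable {𝒢 : ℕ+ → MeasurableSpace Ω} {X : ℕ → Ω → E} {ξ : ℕ → E → Ω → ℝ}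

theorem historyAlgebra_mono : Monotone (historyAlgebra 𝒢 X) := fun _ _ h =>
  sup_le_sup_right (biSup_mono fun _ hn => le_trans hn h) _

theorem measurable_historyAlgebra (N : ℕ) {n : ℕ} (hn : 1 ≤ n) :
    Measurable[historyAlgebra 𝒢 X N] (X n) :=
  measurable_iff_comap_le.2
    ((le_iSup (fun n : ℕ+ => mE.comap (X n)) ⟨n, hn⟩).trans le_sup_right)

theorem le_historyAlgebra {N : ℕ} {n : ℕ+} (hn : n ≤ N) : 𝒢 n ≤ historyAlgebra 𝒢 X N :=
  (le_biSup 𝒢 (show n ∈ {n : ℕ+ | (n : ℕ) ≤ N} from hn)).trans le_sup_left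

theorem measurable_incr_historyAlgebra {N : ℕ} {n : ℕ+}
    (hξ : Measurable[mE.prod (𝒢 n)] fun p : E × Ω => ξ n p.1 p.2) (hn : n ≤ N) :
    Measurable[historyAlgebra 𝒢 X N] (fun ω => ξ n (X n ω) ω) := by
  have hpair : @Measurable _ _ (historyAlgebra 𝒢 X N) (mE.prod (𝒢 n)) (fun ω => (X n ω, ω)) :=
    Measurable.prodMk (measurable_historyAlgebra N n.pos)
      (show @Measurable _ _ (historyAlgebra 𝒢 X N) (𝒢 n) (fun ω => ω) from le_historyAlgebra hn)
  exact hξ.comp hpair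

variable [mΩ : MeasurableSpace Ω]

theorem historyAlgebra_le (h𝒢 : ∀ n, 𝒢 n ≤ mΩ) (hX : modulationAlgebra X ≤ mΩ) (N : ℕ) :
    historyAlgebra 𝒢 X N ≤ mΩ :=
  sup_le (iSup₂_le fun n _ => h𝒢 n) hX

theorem indep_historyAlgebra {Pr : Measure Ω} [IsZeroOrProbabilityMeasure Pr]
    (h𝒢 : ∀ n, 𝒢 n ≤ mΩ) (hX : modulationAlgebra X ≤ mΩ) (hind : iIndep 𝒢 Pr)
    (hindX : Indep (⨆ n, 𝒢 n) (modulationAlgebra X) Pr) (N : ℕ) :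
    Indep (historyAlgebra 𝒢 X N) (𝒢 N.succPNat) Pr := by
  refine indep_sup_left_of_indep_sup (iSup₂_le fun n _ => h𝒢 n) (h𝒢 _) hX ?_
    (indep_of_indep_of_le_left hindX (sup_le (iSup₂_le fun n _ => le_iSup 𝒢 n) (le_iSup 𝒢 _)))
  have hdisj : Disjoint {n : ℕ+ | (n : ℕ) ≤ N} {N.succPNat} :=
    disjoint_singleton_right.2 fun hmem => absurd (show N + 1 ≤ N from hmem) (by lia)
  simpa only [iSup_singleton] using indep_iSup_of_disjoint h𝒢 hind hdisj

/-- A filtration for the argument: an increasing family of `σ`-algebras, the `N`-th of which makes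
measurable the whole modulating process and the first `N` increments, and given which the increment
at time `N + 1` has law `P (X (N + 1))`. -/
structure IsHistory (Pr : Measure Ω) (P : Kernel E ℝ) (X : ℕ → Ω → E) (ξ : ℕ → E → Ω → ℝ)
    (𝓗 : ℕ → MeasurableSpace Ω) : Prop where
  mono : Monotone 𝓗
  le : ∀ N, 𝓗 N ≤ mΩ
  measurable_X : ∀ N n, 1 ≤ n → Measurable[𝓗 N] (X n)
  measurable_incr : ∀ N n, 1 ≤ n → n ≤ N → Measurable[𝓗 N] (fun ω => ξ n (X n ω) ω)
  lintegral_incr : ∀ N (A : Set Ω) (Y : Ω → ℝ) (f : ℝ × ℝ → ℝ≥0∞), MeasurableSet[𝓗 N] A →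
    Measurable[𝓗 N] Y → Measurable f →
    ∫⁻ ω in A, f (Y ω, ξ (N + 1) (X (N + 1) ω) ω) ∂Pr
      = ∫⁻ ω in A, ∫⁻ t, f (Y ω, t) ∂(P (X (N + 1) ω)) ∂Pr

theorem IsModulated.exists_isHistory {Pr : Measure Ω} [IsProbabilityMeasure Pr] {P : Kernel E ℝ}
    (h : IsModulated Pr P X ξ) : ∃ 𝓗, IsHistory Pr P X ξ 𝓗 := by
  obtain ⟨𝒢, h𝒢, hmeas, hind, hindX⟩ := h.indep
  have hX : modulationAlgebra X ≤ mΩ := iSup_le fun n => (h.measurable_X n n.pos).comap_le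
  refine ⟨historyAlgebra 𝒢 X, historyAlgebra_mono, historyAlgebra_le h𝒢 hX,
    fun N n hn => measurable_historyAlgebra N hn,
    fun N n hn hnN => measurable_incr_historyAlgebra (hmeas ⟨n, hn⟩) hnN,
    fun N A Y f hA hY hf => ?_⟩
  have hfst : @Measurable _ _ ((historyAlgebra 𝒢 X N).prod (𝒢 N.succPNat))
      (historyAlgebra 𝒢 X N) (Prod.fst : Ω × Ω → Ω) :=
    @measurable_fst _ _ (historyAlgebra 𝒢 X N) (𝒢 N.succPNat)
  have hsnd : @Measurable _ _ ((historyAlgebra 𝒢 X N).prod (𝒢 N.succPNat)) (𝒢 N.succPNat)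
      (Prod.snd : Ω × Ω → Ω) :=
    @measurable_snd _ _ (historyAlgebra 𝒢 X N) (𝒢 N.succPNat)
  have hincr : Measurable[(historyAlgebra 𝒢 X N).prod (𝒢 N.succPNat)]
      fun p : Ω × Ω => ξ (N + 1) (X (N + 1) p.1) p.2 :=
    (hmeas N.succPNat).comp
      (Measurable.prodMk ((measurable_historyAlgebra N N.succ_pos).comp hfst) hsnd)
  refine (setLIntegral_diag_of_indep (historyAlgebra_le h𝒢 hX N) (h𝒢 _)
    (indep_historyAlgebra h𝒢 hX hind hindX N) hA (hf.comp ((hY.comp hfst).prodMk hincr))).trans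
    (lintegral_congr fun ω => ?_)
  have hξ : Measurable (ξ (N + 1) (X (N + 1) ω)) :=
    ((hmeas N.succPNat).comp (@measurable_prodMk_left E Ω mE (𝒢 N.succPNat) (X (N + 1) ω))).mono
      (h𝒢 _) le_rfl
  rw [← h.law (N + 1) N.succ_pos]
  exact (lintegral_map (f := fun t => f (Y ω, t)) (hf.comp measurable_prodMk_left) hξ).symm

end History

/-! ### Stochastic domination by a walk with independent increments -/

section Domination

variable {μ ν : Measure ℝ}

theorem tendsto_measure_Ioi_sub (μ : Measure ℝ) [IsFiniteMeasure μ] (s : ℝ) :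
    Tendsto (fun r => μ (Ioi (s - r))) (𝓝[>] 0) (𝓝 (μ (Ici s))) := by
  have hIci : ⋂ r > (0 : ℝ), Ioi (s - r) = Ici s := by
    ext z
    simp only [gt_iff_lt, mem_iInter, mem_Ioi, mem_Ici, sub_lt_iff_lt_add]
    exact ⟨le_of_forall_pos_lt_add', fun hz r hr => by linarith⟩
  rw [← hIci]
  exact tendsto_measure_biInter_gt (fun r _ => measurableSet_Ioi.nullMeasurableSet)
    (fun _ _ _ h => Ioi_subset_Ioi (sub_le_sub_left h s)) ⟨1, one_pos, measure_ne_top _ _⟩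

theorem measure_Ici_le_of_tail_le [IsFiniteMeasure μ] [IsFiniteMeasure ν]
    (h : ∀ y, μ (Ioi y) ≤ ν (Ioi y)) (s : ℝ) : μ (Ici s) ≤ ν (Ici s) :=
  le_of_tendsto_of_tendsto' (tendsto_measure_Ioi_sub μ s) (tendsto_measure_Ioi_sub ν s)
    fun r => h (s - r)

theorem isUpperSet_trichotomy {U : Set ℝ} (hU : IsUpperSet U) (hne : U.Nonempty) :
    U = univ ∨ U = Ici (sInf U) ∨ U = Ioi (sInf U) := by
  by_cases hb : BddBelow U
  · refine .inr ?_
    by_cases hs : sInf U ∈ U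
    · exact .inl (Subset.antisymm (fun x hx => csInf_le hb hx) fun x hx => hU hx hs)
    · refine .inr (Subset.antisymm (fun x hx => ?_) fun x hx => ?_)
      · exact lt_of_le_of_ne (csInf_le hb hx) fun he => hs (he ▸ hx)
      · obtain ⟨u, hu, hux⟩ := exists_lt_of_csInf_lt hne hx
        exact hU hux.le hu
  · refine .inl (eq_univ_of_forall fun x => ?_)
    obtain ⟨u, hu, hux⟩ := not_bddBelow_iff.1 hb x
    exact hU hux.le hu

variable [IsProbabilityMeasure μ] [IsProbabilityMeasure ν]

theorem measure_upperSet_le_of_tail_le (h : ∀ y, μ (Ioi y) ≤ ν (Ioi y)) {U : Set ℝ}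
    (hU : IsUpperSet U) : μ U ≤ ν U := by
  rcases U.eq_empty_or_nonempty with rfl | hne
  · simp
  · rcases isUpperSet_trichotomy hU hne with hU | hU | hU
    · rw [hU, measure_univ, measure_univ]
    · rw [hU]
      exact measure_Ici_le_of_tail_le h _
    · rw [hU]
      exact h _

theorem lintegral_mono_of_tail_le (h : ∀ y, μ (Ioi y) ≤ ν (Ioi y)) {f : ℝ → ℝ}
    (hf : Monotone f) (h0 : ∀ t, 0 ≤ f t) :
    ∫⁻ t, ENNReal.ofReal (f t) ∂μ ≤ ∫⁻ t, ENNReal.ofReal (f t) ∂ν := by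
  rw [lintegral_eq_lintegral_meas_lt μ (Eventually.of_forall h0) hf.measurable.aemeasurable,
    lintegral_eq_lintegral_meas_lt ν (Eventually.of_forall h0) hf.measurable.aemeasurable]
  exact lintegral_mono fun t => measure_upperSet_le_of_tail_le h
    fun a b hab ha => lt_of_lt_of_le ha (hf hab)

end Domination

section Exceed

/-- The probability that a random walk with step law `G`, started at `0`, exceeds the level `y`
within `n` steps. -/
noncomputable def exceedWithin (G : Measure ℝ) : ℕ → ℝ → ℝ≥0∞
  | 0, y => if y < 0 then 1 else 0
  | n + 1, y => if y < 0 then 1 else ∫⁻ t, exceedWithin G n (y - t) ∂G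

/-- The probability that a random walk with step law `G`, started at `0`, ever exceeds the level
`y`. -/
noncomputable def exceedProb (G : Measure ℝ) (y : ℝ) : ℝ≥0∞ := ⨆ n, exceedWithin G n y

variable {G : Measure ℝ}

theorem exceedWithin_of_neg (n : ℕ) {y : ℝ} (hy : y < 0) : exceedWithin G n y = 1 := by
  cases n <;> simp [exceedWithin, hy]

variable [IsProbabilityMeasure G]

theorem exceedWithin_le_one (n : ℕ) (y : ℝ) : exceedWithin G n y ≤ 1 := by
  induction n generalizing y with
  | zero =>
    unfold exceedWithin
    split_ifs <;> simp
  | succ n ih =>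
    unfold exceedWithin
    split_ifs
    · exact le_rfl
    · calc ∫⁻ t, exceedWithin G n (y - t) ∂G ≤ ∫⁻ _, 1 ∂G := lintegral_mono fun t => ih _
        _ = 1 := by simp

theorem exceedWithin_antitone (n : ℕ) : Antitone (exceedWithin G n) := by
  induction n with
  | zero =>
    intro x y hxy
    unfold exceedWithin
    split_ifs with h1 h2
    · exact le_rfl
    · linarith
    · exact zero_le
    · exact le_rfl
  | succ n ih =>
    intro x y hxy
    rcases lt_or_ge x 0 with hx | hx
    · rw [exceedWithin_of_neg _ hx]
      exact exceedWithin_le_one _ _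
    · unfold exceedWithin
      rw [if_neg (not_lt.2 hx), if_neg (not_lt.2 (hx.trans hxy))]
      exact lintegral_mono fun t => ih (by linarith)

theorem exceedProb_antitone : Antitone (exceedProb G) := fun _ _ h =>
  iSup_mono fun n => exceedWithin_antitone n h

theorem exceedProb_le_one (y : ℝ) : exceedProb G y ≤ 1 := iSup_le fun n => exceedWithin_le_one n y

theorem lintegral_exceedWithin_mono {μ ν : Measure ℝ} [IsProbabilityMeasure μ]
    [IsProbabilityMeasure ν] (h : ∀ y, μ (Ioi y) ≤ ν (Ioi y)) (n : ℕ) (z : ℝ) :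
    ∫⁻ t, exceedWithin G n (z - t) ∂μ ≤ ∫⁻ t, exceedWithin G n (z - t) ∂ν := by
  have hne : ∀ y, exceedWithin G n y ≠ ∞ := fun y =>
    ((exceedWithin_le_one n y).trans_lt ENNReal.one_lt_top).ne
  have hmono : Monotone fun t => (exceedWithin G n (z - t)).toReal := fun s t hst =>
    ENNReal.toReal_mono (hne _) (exceedWithin_antitone n (by linarith))
  have := lintegral_mono_of_tail_le h hmono fun t => ENNReal.toReal_nonneg
  simpa only [ENNReal.ofReal_toReal (hne _)] using this

end Exceed

section Walk

variable {E Ω : Type*} {X : ℕ → Ω → E} {ξ : ℕ → E → Ω → ℝ}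

@[simp]
theorem walk_zero (ω : Ω) : walk X ξ 0 ω = 0 := by simp [walk]

theorem walk_succ (n : ℕ) (ω : Ω) :
    walk X ξ (n + 1) ω = walk X ξ n ω + ξ (n + 1) (X (n + 1) ω) ω := by
  rw [walk, walk, Finset.sum_Icc_succ_top (by lia)]

variable [MeasurableSpace E] [mΩ : MeasurableSpace Ω] {Pr : Measure Ω} {P : Kernel E ℝ}
  {𝓗 : ℕ → MeasurableSpace Ω}

theorem IsHistory.measurable_walk_of_le (h : IsHistory Pr P X ξ 𝓗) {n N : ℕ} (hn : n ≤ N) :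
    Measurable[𝓗 N] (walk X ξ n) := by
  refine Finset.measurable_fun_sum _ fun i hi => ?_
  rw [Finset.mem_Icc] at hi
  exact h.measurable_incr N i hi.1 (hi.2.trans hn)

theorem IsHistory.measurable_walk (h : IsHistory Pr P X ξ 𝓗) (n : ℕ) :
    Measurable (walk X ξ n) := (h.measurable_walk_of_le le_rfl).mono (h.le n) le_rfl

theorem IsHistory.measurableSet_lt_walk (h : IsHistory Pr P X ξ 𝓗) (n : ℕ) (y : ℝ) :
    MeasurableSet[𝓗 n] {ω | y < walk X ξ n ω} :=
  measurableSet_lt measurable_const (h.measurable_walk_of_le le_rfl)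

theorem IsHistory.measurableSet_inter_compl (h : IsHistory Pr P X ξ 𝓗) {N : ℕ} {A : Set Ω}
    (hA : MeasurableSet[𝓗 N] A) (y : ℝ) :
    MeasurableSet[𝓗 N] (A ∩ {ω | y < walk X ξ N ω}ᶜ) :=
  hA.inter (h.measurableSet_lt_walk N y).compl

variable {G : Measure ℝ}

theorem IsHistory.measure_exceed_zero (h : IsHistory Pr P X ξ 𝓗) (N : ℕ) (A : Set Ω) (y : ℝ) :
    Pr (A ∩ {ω | ∃ k ≤ 0, y < walk X ξ (N + k) ω})
      = ∫⁻ ω in A, exceedWithin G 0 (y - walk X ξ N ω) ∂Pr := by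
  have hm : MeasurableSet {ω | y < walk X ξ N ω} :=
    h.le N _ (h.measurableSet_lt_walk N y)
  have : ∀ ω, exceedWithin G 0 (y - walk X ξ N ω)
      = {ω | y < walk X ξ N ω}.indicator (fun _ => 1) ω := fun ω => by
    simp [exceedWithin, indicator_apply]
  simp only [this]
  rw [lintegral_indicator hm, setLIntegral_one, Measure.restrict_apply hm, inter_comm]
  congr 2
  ext ω
  simp

theorem IsHistory.measure_exceed_succ (h : IsHistory Pr P X ξ 𝓗) (n N : ℕ) (A : Set Ω) (y : ℝ) :
    Pr (A ∩ {ω | ∃ k ≤ n + 1, y < walk X ξ (N + k) ω})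
      = Pr (A ∩ {ω | y < walk X ξ N ω})
        + Pr ((A ∩ {ω | y < walk X ξ N ω}ᶜ) ∩ {ω | ∃ k ≤ n, y < walk X ξ (N + 1 + k) ω}) := by
  have hm : MeasurableSet {ω | y < walk X ξ N ω} :=
    h.le N _ (h.measurableSet_lt_walk N y)
  rw [← measure_inter_add_sdiff _ hm]
  congr 2
  · ext ω
    simp only [mem_inter_iff, mem_ofPred_eq]
    exact ⟨fun hω => ⟨hω.1.1, hω.2⟩, fun hω => ⟨⟨hω.1, 0, by lia, hω.2⟩, hω.2⟩⟩
  · ext ω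
    simp only [mem_inter_iff, mem_ofPred_eq, Set.mem_sdiff, mem_compl_iff]
    constructor
    · rintro ⟨⟨h1, k, hk, h2⟩, h3⟩
      rcases k with _ | k
      · exact absurd h2 h3
      · exact ⟨⟨h1, h3⟩, k, by lia, by rwa [show N + 1 + k = N + (k + 1) by lia]⟩
    · rintro ⟨⟨h1, h3⟩, k, hk, h2⟩
      exact ⟨⟨h1, k + 1, by lia, by rwa [show N + (k + 1) = N + 1 + k by lia]⟩, h3⟩

theorem IsHistory.lintegral_exceedWithin_succ (h : IsHistory Pr P X ξ 𝓗) (n N : ℕ) {A : Set Ω}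
    (hA : MeasurableSet[𝓗 N] A) (y : ℝ) :
    ∫⁻ ω in A, exceedWithin G (n + 1) (y - walk X ξ N ω) ∂Pr
      = Pr (A ∩ {ω | y < walk X ξ N ω})
        + ∫⁻ ω in A ∩ {ω | y < walk X ξ N ω}ᶜ,
            ∫⁻ t, exceedWithin G n (y - walk X ξ N ω - t) ∂G ∂Pr := by
  have hm : MeasurableSet {ω | y < walk X ξ N ω} :=
    h.le N _ (h.measurableSet_lt_walk N y)
  have hAm := h.le N A hA
  rw [← lintegral_inter_add_sdiff _ A hm]
  congr 1
  · rw [← setLIntegral_one]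
    refine setLIntegral_congr_fun (hAm.inter hm) fun ω hω => ?_
    exact exceedWithin_of_neg _ (sub_neg.2 hω.2)
  · refine setLIntegral_congr_fun (hAm.diff hm) fun ω hω => ?_
    have : ¬ y - walk X ξ N ω < 0 := fun hlt => hω.2 (sub_neg.1 hlt)
    simp only [exceedWithin, if_neg this]

variable [IsProbabilityMeasure G]

theorem IsHistory.lintegral_exceedWithin_walk_succ (h : IsHistory Pr P X ξ 𝓗) (n N : ℕ)
    {A : Set Ω} (hA : MeasurableSet[𝓗 N] A) (y : ℝ) :
    ∫⁻ ω in A, exceedWithin G n (y - walk X ξ (N + 1) ω) ∂Pr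
      = ∫⁻ ω in A, ∫⁻ t, exceedWithin G n (y - walk X ξ N ω - t) ∂(P (X (N + 1) ω)) ∂Pr := by
  have := h.lintegral_incr N A (fun ω => y - walk X ξ N ω)
    (fun p => exceedWithin G n (p.1 - p.2)) hA
    (measurable_const.sub (h.measurable_walk_of_le le_rfl))
    ((exceedWithin_antitone n).measurable.comp (measurable_fst.sub measurable_snd))
  rw [← this]
  refine lintegral_congr fun ω => ?_
  rw [walk_succ, sub_sub]

theorem IsHistory.measure_exceedWithin_le [IsMarkovKernel P] (h : IsHistory Pr P X ξ 𝓗)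
    (hG : ∀ x y, P x (Ioi y) ≤ G (Ioi y)) (n N : ℕ) {A : Set Ω} (hA : MeasurableSet[𝓗 N] A)
    (y : ℝ) :
    Pr (A ∩ {ω | ∃ k ≤ n, y < walk X ξ (N + k) ω})
      ≤ ∫⁻ ω in A, exceedWithin G n (y - walk X ξ N ω) ∂Pr := by
  induction n generalizing N A with
  | zero => exact (h.measure_exceed_zero N A y).le
  | succ n ih =>
    rw [h.measure_exceed_succ n N A, h.lintegral_exceedWithin_succ n N hA]
    refine add_le_add_right
      ((ih (N + 1) (h.mono N.le_succ _ (h.measurableSet_inter_compl hA y))).trans ?_) _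
    rw [h.lintegral_exceedWithin_walk_succ n N (h.measurableSet_inter_compl hA y)]
    exact lintegral_mono fun ω => lintegral_exceedWithin_mono (fun y => hG _ y) n _

theorem IsHistory.measure_exceedWithin_eq (h : IsHistory Pr P X ξ 𝓗) (hG : ∀ x, P x = G)
    (n N : ℕ) {A : Set Ω} (hA : MeasurableSet[𝓗 N] A) (y : ℝ) :
    Pr (A ∩ {ω | ∃ k ≤ n, y < walk X ξ (N + k) ω})
      = ∫⁻ ω in A, exceedWithin G n (y - walk X ξ N ω) ∂Pr := by
  induction n generalizing N A with
  | zero => exact h.measure_exceed_zero N A y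
  | succ n ih =>
    rw [h.measure_exceed_succ n N A, h.lintegral_exceedWithin_succ n N hA,
      ih (N + 1) (h.mono N.le_succ _ (h.measurableSet_inter_compl hA y)),
      h.lintegral_exceedWithin_walk_succ n N (h.measurableSet_inter_compl hA y)]
    simp only [hG]

theorem IsHistory.measure_exceed_le [IsMarkovKernel P] (h : IsHistory Pr P X ξ 𝓗)
    (hG : ∀ x y, P x (Ioi y) ≤ G (Ioi y)) (N : ℕ) {A : Set Ω} (hA : MeasurableSet[𝓗 N] A)
    (y : ℝ) :
    Pr (A ∩ {ω | ∃ k, y < walk X ξ (N + k) ω})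
      ≤ ∫⁻ ω in A, exceedProb G (y - walk X ξ N ω) ∂Pr := by
  have hU : A ∩ {ω | ∃ k, y < walk X ξ (N + k) ω}
      = ⋃ n, A ∩ {ω | ∃ k ≤ n, y < walk X ξ (N + k) ω} := by
    ext ω
    simp only [mem_inter_iff, mem_ofPred_eq, mem_iUnion]
    exact ⟨fun ⟨h1, k, h2⟩ => ⟨k, h1, k, le_rfl, h2⟩, fun ⟨_, h1, k, _, h2⟩ => ⟨h1, k, h2⟩⟩
  have hmono : Monotone fun n => A ∩ {ω | ∃ k ≤ n, y < walk X ξ (N + k) ω} :=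
    fun m n hmn => inter_subset_inter_right _ fun ω ⟨k, hk, hω⟩ => ⟨k, hk.trans hmn, hω⟩
  rw [hU, hmono.measure_iUnion]
  refine iSup_le fun n => (h.measure_exceedWithin_le hG n N hA y).trans ?_
  exact lintegral_mono fun ω => le_iSup (fun n => exceedWithin G n (y - walk X ξ N ω)) n

theorem IsHistory.exceedProb_le [IsProbabilityMeasure Pr] (h : IsHistory Pr P X ξ 𝓗)
    (hG : ∀ x, P x = G) (y : ℝ) :
    exceedProb G y ≤ Pr {ω | ∃ k, y < walk X ξ k ω} := by
  refine iSup_le fun n => ?_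
  have := h.measure_exceedWithin_eq hG n 0 (A := univ) MeasurableSet.univ y
  simp only [walk_zero, sub_zero, Measure.restrict_univ, lintegral_const, measure_univ, mul_one,
    univ_inter, zero_add] at this
  rw [← this]
  exact measure_mono fun ω ⟨k, _, hk⟩ => ⟨k, hk⟩

end Walk

/-! ### Decomposition at the first passage over a receding barrier -/

section BoundedSequence

variable {Ω : Type*} [MeasurableSpace Ω] {Pr : Measure Ω}

theorem exists_measure_exists_gt_le [IsFiniteMeasure Pr] {f : ℕ → Ω → ℝ}
    (hf : ∀ n, Measurable (f n)) (hb : ∀ᵐ ω ∂Pr, BddAbove (range fun n => f n ω)) {δ : ℝ≥0∞}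
    (hδ : 0 < δ) : ∃ K : ℝ, 0 ≤ K ∧ Pr {ω | ∃ n, K < f n ω} ≤ δ := by
  have hmeas (K : ℕ) : MeasurableSet {ω | ∃ n, (K : ℝ) < f n ω} := by
    simp only [ofPred_exists]
    exact MeasurableSet.iUnion fun n => measurableSet_lt measurable_const (hf n)
  have hanti : Antitone fun K : ℕ => {ω | ∃ n, (K : ℝ) < f n ω} :=
    fun K K' hK ω ⟨n, hn⟩ => ⟨n, lt_of_le_of_lt (Nat.cast_le.2 hK) hn⟩
  have hlim := tendsto_measure_iInter_atTop (μ := Pr) (fun K => (hmeas K).nullMeasurableSet) hanti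
    ⟨0, measure_ne_top _ _⟩
  have hzero : Pr (⋂ K : ℕ, {ω | ∃ n, (K : ℝ) < f n ω}) = 0 := by
    refine measure_mono_null (fun ω hω => ?_) (ae_iff.1 hb)
    rintro ⟨b, hbd⟩
    obtain ⟨K, hK⟩ := exists_nat_ge b
    obtain ⟨n, hn⟩ := mem_iInter.1 hω K
    exact (hn.trans_le (hbd ⟨n, rfl⟩)).not_ge hK
  rw [hzero] at hlim
  obtain ⟨K, hK⟩ := (hlim.eventually (gt_mem_nhds hδ)).exists
  exact ⟨K, K.cast_nonneg, hK.le⟩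

theorem exists_measure_exists_add_mul_lt_le [IsFiniteMeasure Pr] {f : ℕ → Ω → ℝ}
    (hf : ∀ n, Measurable (f n)) {b β : ℝ} (hβ : b < β)
    (hlim : ∀ᵐ ω ∂Pr, Tendsto (fun n : ℕ => f n ω / n) atTop (𝓝 b)) {δ : ℝ≥0∞} (hδ : 0 < δ) :
    ∃ K : ℝ, 0 ≤ K ∧ Pr {ω | ∃ n : ℕ, K + β * n < f n ω} ≤ δ := by
  have hb : ∀ᵐ ω ∂Pr, BddAbove (range fun n : ℕ => f n ω - β * n) := by
    filter_upwards [hlim] with ω hω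
    refine IsBoundedUnder.bddAbove_range ⟨0, eventually_map.2 ?_⟩
    filter_upwards [hω.eventually (gt_mem_nhds hβ), eventually_gt_atTop 0] with n hn hn0
    rw [div_lt_iff₀ (Nat.cast_pos.2 hn0)] at hn
    exact sub_nonpos.2 hn.le
  simpa only [lt_sub_iff_add_lt] using
    exists_measure_exists_gt_le (fun n => (hf n).sub_const (β * n)) hb hδ

end BoundedSequence

section Barrier

/-- The event that the walk passes above the barrier `K - α n` for the first time at time `n`. -/
def firstPassage {E Ω : Type*} (X : ℕ → Ω → E) (ξ : ℕ → E → Ω → ℝ) (K α : ℝ) (n : ℕ) : Set Ω :=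
  {ω | K - α * n < walk X ξ n ω ∧ ∀ k < n, walk X ξ k ω ≤ K - α * k}

variable {E Ω : Type*} {X : ℕ → Ω → E} {ξ : ℕ → E → Ω → ℝ}

theorem pairwise_disjoint_firstPassage (K α : ℝ) :
    Pairwise (Function.onFun Disjoint (firstPassage X ξ K α)) := by
  refine fun i j hij => Set.disjoint_left.2 fun ω hi hj => ?_
  rcases lt_or_gt_of_ne hij with hlt | hlt
  · exact hi.1.not_ge (hj.2 i hlt)
  · exact hj.1.not_ge (hi.2 j hlt)

theorem exists_mem_firstPassage {K α : ℝ} (hK : 0 ≤ K) {ω : Ω} {k : ℕ}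
    (hk : K - α * k < walk X ξ k ω) : ∃ n < k, ω ∈ firstPassage X ξ K α (n + 1) := by
  classical
  have hex : ∃ n : ℕ, K - α * n < walk X ξ n ω := ⟨k, hk⟩
  have hpass : ω ∈ firstPassage X ξ K α (Nat.find hex) :=
    ⟨Nat.find_spec hex, fun j hj => not_lt.1 (Nat.find_min hex hj)⟩
  obtain ⟨n, hn⟩ : ∃ n, Nat.find hex = n + 1 := by
    refine Nat.exists_eq_succ_of_ne_zero fun h0 => hK.not_gt ?_
    simpa [h0] using Nat.find_spec hex
  exact ⟨n, Nat.lt_of_succ_le (hn.symm.trans_le (Nat.find_min' hex hk)), hn ▸ hpass⟩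

theorem exceed_subset_iUnion_firstPassage {K α : ℝ} (hK : 0 ≤ K) (hα : 0 ≤ α) {y : ℝ} (hy : K ≤ y)
    (v : ℝ) :
    {ω | ∃ k, y < walk X ξ k ω} ⊆
      ⋃ n : ℕ, (firstPassage X ξ K α (n + 1) ∩ walk X ξ (n + 1) ⁻¹' Ioi v) ∪
        ((firstPassage X ξ K α (n + 1) ∩ walk X ξ (n + 1) ⁻¹' Iic v) ∩
          {ω | ∃ k, y < walk X ξ (n + 1 + k) ω}) := by
  rintro ω ⟨k, hk⟩
  have hbarrier : K - α * k < walk X ξ k ω := by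
    have : 0 ≤ α * k := by positivity
    linarith
  obtain ⟨n, hnk, hn⟩ := exists_mem_firstPassage hK hbarrier
  refine mem_iUnion.2 ⟨n, ?_⟩
  rcases lt_or_ge v (walk X ξ (n + 1) ω) with hv | hv
  · exact .inl ⟨hn, hv⟩
  · exact .inr ⟨⟨hn, hv⟩, k - (n + 1), by rwa [Nat.add_sub_cancel' hnk]⟩

variable [MeasurableSpace E] [MeasurableSpace Ω] {Pr : Measure Ω} {P : Kernel E ℝ}
  {𝓗 : ℕ → MeasurableSpace Ω} {a : ℝ}

theorem IsHistory.exists_barrier [IsFiniteMeasure Pr] (h : IsHistory Pr P X ξ 𝓗)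
    (hd : HasDrift Pr X ξ a) {α : ℝ} (hα : α < a) {δ : ℝ≥0∞} (hδ : 0 < δ) :
    ∃ K : ℝ, 0 ≤ K ∧ Pr {ω | ∃ n : ℕ, K - α * n < walk X ξ n ω} ≤ δ := by
  simpa only [neg_mul, ← sub_eq_add_neg] using
    exists_measure_exists_add_mul_lt_le h.measurable_walk (neg_lt_neg hα) hd hδ

theorem IsHistory.exists_lower_barrier [IsFiniteMeasure Pr] (h : IsHistory Pr P X ξ 𝓗)
    (hd : HasDrift Pr X ξ a) {β : ℝ} (hβ : a < β) {δ : ℝ≥0∞} (hδ : 0 < δ) :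
    ∃ K : ℝ, 0 ≤ K ∧ Pr {ω | ∃ n : ℕ, walk X ξ n ω < -K - β * n} ≤ δ := by
  have hneg : ∀ᵐ ω ∂Pr, Tendsto (fun n : ℕ => -walk X ξ n ω / n) atTop (𝓝 a) := by
    filter_upwards [hd] with ω hω
    simpa only [neg_div, neg_neg] using hω.neg
  obtain ⟨K, hK0, hK⟩ := exists_measure_exists_add_mul_lt_le
    (f := fun n ω => -walk X ξ n ω) (fun n => (h.measurable_walk n).neg) hβ hneg hδ
  refine ⟨K, hK0, (measure_mono ?_).trans hK⟩
  exact fun ω ⟨n, hn⟩ => ⟨n, by linarith⟩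

theorem IsHistory.measure_inter_incr_gt (h : IsHistory Pr P X ξ 𝓗) (N : ℕ) {A : Set Ω}
    (hA : MeasurableSet[𝓗 N] A) (z : ℝ) :
    Pr (A ∩ {ω | z < ξ (N + 1) (X (N + 1) ω) ω}) = ∫⁻ ω in A, P (X (N + 1) ω) (Ioi z) ∂Pr := by
  have hm : MeasurableSet {ω | z < ξ (N + 1) (X (N + 1) ω) ω} := measurableSet_lt measurable_const
    ((h.measurable_incr (N + 1) (N + 1) (by lia) le_rfl).mono (h.le _) le_rfl)
  have hincr := h.lintegral_incr N A (fun _ => 0) (fun p => (Ioi z).indicator (fun _ => 1) p.2) hA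
    measurable_const ((measurable_const.indicator measurableSet_Ioi).comp measurable_snd)
  simp only [lintegral_indicator_const measurableSet_Ioi, one_mul] at hincr
  rw [← hincr, inter_comm, ← Measure.restrict_apply hm, ← lintegral_indicator_one hm]
  rfl

theorem IsHistory.measurableSet_firstPassage (h : IsHistory Pr P X ξ 𝓗) (K α : ℝ) (n : ℕ) :
    MeasurableSet[𝓗 n] (firstPassage X ξ K α n) := by
  refine (h.measurableSet_lt_walk n _).inter
    (?_ : MeasurableSet[𝓗 n] {ω | ∀ k < n, walk X ξ k ω ≤ K - α * k})
  simp only [ofPred_forall]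
  exact MeasurableSet.iInter fun k => MeasurableSet.iInter fun hk =>
    measurableSet_le (h.measurable_walk_of_le hk.le) measurable_const

end Barrier

section PassageLaw

variable {E Ω : Type*} [MeasurableSpace Ω] {Pr : Measure Ω} {X : ℕ → Ω → E}
  {ξ : ℕ → E → Ω → ℝ} {K α : ℝ}

/-- The (defective) law of the position at the first passage over the barrier `K - α n`, restricted
to the event that this barrier is passed at a time `n ≥ 1`. -/
noncomputable def passageLaw (Pr : Measure Ω) (X : ℕ → Ω → E) (ξ : ℕ → E → Ω → ℝ) (K α : ℝ) :
    Measure ℝ :=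
  Measure.sum fun n : ℕ => (Pr.restrict (firstPassage X ξ K α (n + 1))).map (walk X ξ (n + 1))

variable [MeasurableSpace E] {P : Kernel E ℝ} {𝓗 : ℕ → MeasurableSpace Ω}

theorem IsHistory.passageLaw_apply (h : IsHistory Pr P X ξ 𝓗) {U : Set ℝ} (hU : MeasurableSet U) :
    passageLaw Pr X ξ K α U
      = ∑' n : ℕ, Pr (firstPassage X ξ K α (n + 1) ∩ walk X ξ (n + 1) ⁻¹' U) := by
  simp only [passageLaw, Measure.sum_apply _ hU, Measure.map_apply (h.measurable_walk _) hU,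
    Measure.restrict_apply (h.measurable_walk _ hU), inter_comm]

theorem IsHistory.passageLaw_univ_le (h : IsHistory Pr P X ξ 𝓗) :
    passageLaw Pr X ξ K α univ ≤ Pr {ω | ∃ n : ℕ, K - α * n < walk X ξ n ω} := by
  simp only [h.passageLaw_apply MeasurableSet.univ, preimage_univ, inter_univ]
  rw [← measure_iUnion ((pairwise_disjoint_firstPassage K α).comp_of_injective
    (add_left_injective 1)) fun n => h.le _ _ (h.measurableSet_firstPassage K α _)]
  exact measure_mono (iUnion_subset fun n ω hω => ⟨n + 1, hω.1⟩)

-- The walk is below `K - α n` at time `n`, so it can only pass `z` at time `n + 1` by a large jump.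
theorem IsHistory.passageLaw_Ioi_le (h : IsHistory Pr P X ξ 𝓗) (z : ℝ) :
    passageLaw Pr X ξ K α (Ioi z) ≤ jumpSum Pr P X univ α (z - (K + α)) := by
  rw [h.passageLaw_apply measurableSet_Ioi, jumpSum]
  refine ENNReal.tsum_le_tsum fun n => ?_
  rw [jumpProb, preimage_univ, ← h.measure_inter_incr_gt n MeasurableSet.univ, univ_inter]
  refine measure_mono fun ω ⟨⟨_, hbelow⟩, hz⟩ => ?_
  have hn : walk X ξ n ω ≤ K - α * n := hbelow n n.lt_succ_self
  rw [mem_preimage, mem_Ioi, walk_succ] at hz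
  change z - (K + α) + α * (n + 1) < ξ (n + 1) (X (n + 1) ω) ω
  linarith

theorem IsHistory.setLIntegral_passageLaw (h : IsHistory Pr P X ξ 𝓗) {U : Set ℝ}
    (hU : MeasurableSet U) {f : ℝ → ℝ≥0∞} (hf : Measurable f) :
    ∫⁻ s in U, f s ∂passageLaw Pr X ξ K α
      = ∑' n : ℕ, ∫⁻ ω in firstPassage X ξ K α (n + 1) ∩ walk X ξ (n + 1) ⁻¹' U,
          f (walk X ξ (n + 1) ω) ∂Pr := by
  rw [passageLaw, Measure.restrict_sum _ hU, lintegral_sum_measure]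
  refine tsum_congr fun n => ?_
  rw [setLIntegral_map hU hf (h.measurable_walk _),
    Measure.restrict_restrict (h.measurable_walk _ hU), inter_comm]

theorem IsHistory.measure_exceed_le_passageLaw [IsMarkovKernel P] {G : Measure ℝ}
    [IsProbabilityMeasure G] (h : IsHistory Pr P X ξ 𝓗) (hG : ∀ x y, P x (Ioi y) ≤ G (Ioi y))
    (hK : 0 ≤ K) (hα : 0 ≤ α) {y : ℝ} (hy : K ≤ y) (v : ℝ) :
    Pr {ω | ∃ k, y < walk X ξ k ω} ≤ passageLaw Pr X ξ K α (Ioi v)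
      + ∫⁻ s in Iic v, exceedProb G (y - s) ∂passageLaw Pr X ξ K α := by
  have hm : Measurable fun s => exceedProb G (y - s) :=
    exceedProb_antitone.measurable.comp (measurable_const.sub measurable_id)
  rw [h.setLIntegral_passageLaw measurableSet_Iic hm, h.passageLaw_apply measurableSet_Ioi,
    ← ENNReal.tsum_add]
  refine (measure_mono (exceed_subset_iUnion_firstPassage hK hα hy v)).trans
    ((measure_iUnion_le _).trans (ENNReal.tsum_le_tsum fun n => ?_))
  refine (measure_union_le _ _).trans (add_le_add_right ?_ _)
  exact h.measure_exceed_le hG (n + 1) ((h.measurableSet_firstPassage K α _).inter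
    (h.measurable_walk_of_le le_rfl measurableSet_Iic)) y

end PassageLaw

/-! ### The dominating walk -/

open scoped NNReal

section DominatingLaw

variable {G G' F : Measure ℝ} {L : ℝ≥0}

/-- The distribution function whose tail is the minimum of the tail of `G` and of `L` times the
tail of `F`. -/
noncomputable def minTailCDF (G F : Measure ℝ) (L : ℝ≥0) : StieltjesFunction ℝ where
  toFun y := max (cdf G y) (1 - L * (1 - cdf F y))
  mono' x y h := by
    have hG := monotone_cdf G h
    have hF := monotone_cdf F h
    dsimp only
    gcongr
  right_continuous' x := ((cdf G).right_continuous x).max (continuousWithinAt_const.sub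
    (continuousWithinAt_const.mul (continuousWithinAt_const.sub ((cdf F).right_continuous x))))

theorem tendsto_minTailCDF_atTop : Tendsto (minTailCDF G F L) atTop (𝓝 1) := by
  have h : Tendsto (minTailCDF G F L) atTop (𝓝 (max 1 (1 - L * (1 - 1)))) :=
    (tendsto_cdf_atTop G).max (((tendsto_cdf_atTop F).const_sub 1).const_mul (L : ℝ)
      |>.const_sub 1)
  rwa [sub_self, mul_zero, sub_zero, max_self] at h

theorem tendsto_minTailCDF_atBot (hL : 1 ≤ L) : Tendsto (minTailCDF G F L) atBot (𝓝 0) := by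
  have h : Tendsto (minTailCDF G F L) atBot (𝓝 (max 0 (1 - L * (1 - 0)))) :=
    (tendsto_cdf_atBot G).max (((tendsto_cdf_atBot F).const_sub 1).const_mul (L : ℝ)
      |>.const_sub 1)
  rwa [sub_zero, mul_one, max_eq_left (sub_nonpos.2 (mod_cast hL))] at h

theorem lintegral_ofReal_neg_eq (ρ : Measure ℝ) :
    ∫⁻ t, ENNReal.ofReal (-t) ∂ρ = ∫⁻ s in Ioi 0, ρ (Iic (-s)) := by
  have hlayer := lintegral_eq_lintegral_meas_le ρ (f := fun t => max (-t) 0)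
    (Eventually.of_forall fun t => le_max_right _ _) (by fun_prop)
  simp only [ENNReal.ofReal_max, ENNReal.ofReal_zero, max_eq_left zero_le] at hlayer
  rw [hlayer]
  refine setLIntegral_congr_fun measurableSet_Ioi fun s hs => congrArg ρ ?_
  ext t
  simp [not_le.2 (mem_Ioi.1 hs), le_neg]

theorem ofReal_norm_eq_add (t : ℝ) :
    ENNReal.ofReal ‖t‖ = ENNReal.ofReal t + ENNReal.ofReal (-t) := by
  rcases le_total t 0 with h | h
  · rw [Real.norm_of_nonpos h, ENNReal.ofReal_of_nonpos h, zero_add]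
  · rw [Real.norm_of_nonneg h, ENNReal.ofReal_of_nonpos (neg_nonpos.2 h), add_zero]

variable [IsProbabilityMeasure G] [IsProbabilityMeasure G']

theorem lintegral_ofReal_le_of_tail_le (hle : ∀ y, G' (Ioi y) ≤ G (Ioi y)) :
    ∫⁻ t, ENNReal.ofReal t ∂G' ≤ ∫⁻ t, ENNReal.ofReal t ∂G := by
  simpa only [ENNReal.ofReal_max, ENNReal.ofReal_zero, max_eq_left zero_le] using
    lintegral_mono_of_tail_le hle (f := fun t => max t 0) (fun s t h => max_le_max_right 0 h)
      (fun t => le_max_right _ _)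

theorem integrable_id_of_tail_le (hG : Integrable (fun t : ℝ => t) G)
    (hle : ∀ y, G' (Ioi y) ≤ G (Ioi y)) (heq : ∀ y < 0, G' (Iic y) = G (Iic y)) :
    Integrable (fun t : ℝ => t) G' := by
  have hneg : ∫⁻ t, ENNReal.ofReal (-t) ∂G' = ∫⁻ t, ENNReal.ofReal (-t) ∂G := by
    rw [lintegral_ofReal_neg_eq, lintegral_ofReal_neg_eq]
    exact setLIntegral_congr_fun measurableSet_Ioi fun s hs => heq _ (neg_lt_zero.2 hs)
  refine ⟨measurable_id.aestronglyMeasurable, ?_⟩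
  simp only [hasFiniteIntegral_iff_norm, ofReal_norm_eq_add]
  rw [lintegral_add_left ENNReal.measurable_ofReal, hneg]
  exact ENNReal.add_lt_top.2
    ⟨(lintegral_ofReal_le_of_tail_le hle).trans_lt hG.lintegral_lt_top, hG.neg.lintegral_lt_top⟩

theorem integral_id_le_of_tail_le (hG : Integrable (fun t : ℝ => t) G)
    (hG' : Integrable (fun t : ℝ => t) G') (hle : ∀ y, G' (Ioi y) ≤ G (Ioi y)) :
    ∫ t, t ∂G' ≤ ∫ t, t ∂G := by
  have hneg : ∫⁻ t, ENNReal.ofReal (-t) ∂G ≤ ∫⁻ t, ENNReal.ofReal (-t) ∂G' := by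
    rw [lintegral_ofReal_neg_eq, lintegral_ofReal_neg_eq]
    refine lintegral_mono fun s => ?_
    rw [← compl_Ioi, prob_compl_eq_one_sub measurableSet_Ioi,
      prob_compl_eq_one_sub measurableSet_Ioi]
    exact tsub_le_tsub_left (hle _) 1
  rw [integral_eq_lintegral_pos_part_sub_lintegral_neg_part hG',
    integral_eq_lintegral_pos_part_sub_lintegral_neg_part hG]
  exact sub_le_sub
    (ENNReal.toReal_mono hG.lintegral_lt_top.ne (lintegral_ofReal_le_of_tail_le hle))
    (ENNReal.toReal_mono hG'.neg.lintegral_lt_top.ne hneg)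

variable [IsProbabilityMeasure F]

theorem measure_minTailCDF_Ioi (y : ℝ) :
    (minTailCDF G F L).measure (Ioi y) = min (G (Ioi y)) (L * F (Ioi y)) := by
  have hcdf (μ : Measure ℝ) [IsProbabilityMeasure μ] :
      μ (Ioi y) = ENNReal.ofReal (1 - cdf μ y) := by
    rw [cdf_eq_real, ← probReal_compl_eq_one_sub measurableSet_Iic, compl_Iic, ofReal_measureReal]
  rw [StieltjesFunction.measure_Ioi _ tendsto_minTailCDF_atTop, hcdf G, hcdf F,
    ← ENNReal.ofReal_coe_nnreal, ← ENNReal.ofReal_mul L.coe_nonneg, ← ENNReal.ofReal_min]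
  refine congrArg ENNReal.ofReal ?_
  change 1 - max (cdf G y) (1 - L * (1 - cdf F y)) = _
  rw [← min_sub_sub_left, sub_sub_cancel]

theorem exists_law_min_tail (hG : Integrable (fun t : ℝ => t) G) (hL : 1 ≤ L * F (Ioi 0)) :
    ∃ G' : Measure ℝ, IsProbabilityMeasure G' ∧ Integrable (fun t : ℝ => t) G' ∧
      ∫ t, t ∂G' ≤ ∫ t, t ∂G ∧ ∀ y, G' (Ioi y) = min (G (Ioi y)) (L * F (Ioi y)) := by
  have hL1 : 1 ≤ L := ENNReal.one_le_coe_iff.1 (hL.trans (mul_le_of_le_one_right' prob_le_one))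
  have hprob : IsProbabilityMeasure (minTailCDF G F L).measure :=
    StieltjesFunction.isProbabilityMeasure _ (tendsto_minTailCDF_atBot hL1)
      tendsto_minTailCDF_atTop
  have hle (y : ℝ) : (minTailCDF G F L).measure (Ioi y) ≤ G (Ioi y) :=
    (measure_minTailCDF_Ioi y).trans_le (min_le_left _ _)
  have heq (y : ℝ) (hy : y < 0) : (minTailCDF G F L).measure (Iic y) = G (Iic y) := by
    have hone : 1 ≤ L * F (Ioi y) :=
      hL.trans (mul_le_mul_right (measure_mono (Ioi_subset_Ioi hy.le)) _)
    rw [← compl_Ioi, prob_compl_eq_one_sub measurableSet_Ioi,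
      prob_compl_eq_one_sub measurableSet_Ioi, measure_minTailCDF_Ioi,
      min_eq_left (prob_le_one.trans hone)]
  have hint := integrable_id_of_tail_le hG hle heq
  exact ⟨_, hprob, hint, integral_id_le_of_tail_le hG hint hle, measure_minTailCDF_Ioi⟩

end DominatingLaw

section IIDWalk

variable (G : Measure ℝ) [IsProbabilityMeasure G]

theorem iIndepFun_eval_infinitePi :
    iIndepFun (fun (i : ℕ) (ω : ℕ → ℝ) => ω i) (Measure.infinitePi fun _ : ℕ => G) :=
  iIndepFun_infinitePi (P := fun _ : ℕ => G) (X := fun _ t => t) fun _ => measurable_id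

theorem isModulated_infinitePi :
    IsModulated (Measure.infinitePi fun _ : ℕ => G) (Kernel.const Unit G) (fun _ _ => ())
      (fun n _ ω => ω n) where
  measurable_X n _ := measurable_const
  law n _ x := by
    rw [Kernel.const_apply]
    exact Measure.infinitePi_map_eval (fun _ : ℕ => G) n
  indep := by
    refine ⟨fun n => MeasurableSpace.comap (fun ω : ℕ → ℝ => ω n) inferInstance, fun n => ?_,
      fun n => ?_, ?_, ?_⟩
    · exact (measurable_pi_apply (n : ℕ)).comap_le
    · exact (comap_measurable (fun ω : ℕ → ℝ => ω n)).comp (@measurable_snd _ _ _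
        (MeasurableSpace.comap (fun ω : ℕ → ℝ => ω n) inferInstance))
    · exact (iIndepFun_eval_infinitePi G).precomp (g := ((↑) : ℕ+ → ℕ)) PNat.coe_injective
    · simp only [MeasurableSpace.comap_const, iSup_bot]
      exact indep_bot_right _

theorem hasDrift_infinitePi (hG : Integrable (fun t : ℝ => t) G) :
    HasDrift (Measure.infinitePi fun _ : ℕ => G) (fun _ _ => ()) (fun n (_ : Unit) ω => ω n)
      (-∫ t, t ∂G) := by
  have hmp (i : ℕ) : MeasurePreserving (fun ω : ℕ → ℝ => ω i) (Measure.infinitePi fun _ => G) G :=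
    measurePreserving_eval_infinitePi (fun _ : ℕ => G) i
  have hslln := strong_law_ae_real (μ := Measure.infinitePi fun _ : ℕ => G)
    (fun i ω => ω (i + 1)) ((hmp 1).integrable_comp_of_integrable hG)
    (fun i j hij => (iIndepFun_eval_infinitePi G).indepFun (by lia))
    (fun i => ⟨(hmp _).aemeasurable, (hmp _).aemeasurable, by rw [(hmp _).map_eq, (hmp _).map_eq]⟩)
  have hmean : ∫ ω, ω (0 + 1) ∂(Measure.infinitePi fun _ : ℕ => G) = ∫ t, t ∂G := by
    have := integral_map (hmp (0 + 1)).aemeasurable (f := fun t : ℝ => t)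
      measurable_id.aestronglyMeasurable
    rw [(hmp (0 + 1)).map_eq] at this
    exact this.symm
  rw [hmean] at hslln
  filter_upwards [hslln] with ω hω
  rw [neg_neg]
  refine hω.congr fun n => ?_
  rw [walk, Finset.range_eq_Ico, Finset.sum_Ico_add' (fun i => ω i) 0 n 1]
  rfl

end IIDWalk

/-! ### Upper bounds for the supremum -/

section Core

variable {Q ρ : Measure ℝ}

theorem lintegral_tail_le_prod [SFinite Q] [SFinite ρ] {C : ℝ≥0∞} {h : ℝ}
    (hρ : ∀ z, h ≤ z → ρ (Ioi z) ≤ C * Q (Ioi z)) (y : ℝ) :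
    ∫⁻ s in Ioc h (y - h), Q (Ioi (y - s)) ∂ρ
      ≤ C * (Q.prod Q) {p | h < p.1 ∧ h < p.2 ∧ y < p.1 + p.2} := by
  set D : Set (ℝ × ℝ) := {p | h < p.1 ∧ h < p.2 ∧ y < p.1 + p.2} with hD
  have hDm : MeasurableSet D := by measurability
  have hsection (v : ℝ) : ρ ((fun s => (s, v)) ⁻¹' D) ≤ C * Q ((fun s => (s, v)) ⁻¹' D) := by
    by_cases hv : h < v
    · have hIoi : (fun s => (s, v)) ⁻¹' D = Ioi (max h (y - v)) := by
        ext s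
        simp [hD, hv, sub_lt_iff_lt_add]
      rw [hIoi]
      exact hρ _ (le_max_left _ _)
    · simp [hD, hv]
  calc ∫⁻ s in Ioc h (y - h), Q (Ioi (y - s)) ∂ρ
      ≤ ∫⁻ s in Ioc h (y - h), Q (Prod.mk s ⁻¹' D) ∂ρ := by
        refine setLIntegral_mono (measurable_measure_prodMk_left hDm) fun s hs => ?_
        exact measure_mono fun v hv =>
          ⟨hs.1, (le_sub_comm.1 hs.2).trans_lt hv, sub_lt_iff_lt_add'.1 hv⟩
    _ ≤ ∫⁻ s, Q (Prod.mk s ⁻¹' D) ∂ρ := setLIntegral_le_lintegral _ _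
    _ = ∫⁻ v, ρ ((fun s => (s, v)) ⁻¹' D) ∂Q := by
        rw [← Measure.prod_apply hDm, Measure.prod_apply_symm hDm]
    _ ≤ ∫⁻ v, C * Q ((fun s => (s, v)) ⁻¹' D) ∂Q := lintegral_mono hsection
    _ = C * (Q.prod Q) D := by
        rw [lintegral_const_mul _ (measurable_measure_prodMk_right hDm),
          Measure.prod_apply_symm hDm]

variable {m : ℝ → ℝ≥0∞}

theorem setLIntegral_comp_sub_le (hm : Antitone m) {h y : ℝ} (hh : 0 ≤ h) (hy : 2 * h ≤ y)
    {R : ℝ≥0∞} (hR : ∀ z ∈ Icc 0 y, m z ≤ R * Q (Ioi z)) :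
    ∫⁻ s in Iic (y - h), m (y - s) ∂ρ
      ≤ R * (Q (Ioi (y - h)) * ρ univ + ∫⁻ s in Ioc h (y - h), Q (Ioi (y - s)) ∂ρ) := by
  have hQm : Measurable fun s => Q (Ioi (y - s)) :=
    (measurable_measure_Ioi Q).comp (measurable_const.sub measurable_id)
  rw [← Iic_union_Ioc_eq_Iic (show h ≤ y - h by linarith), mul_add, ← mul_assoc]
  refine (lintegral_union_le _ _ _).trans (add_le_add ?_ ?_)
  · calc ∫⁻ s in Iic h, m (y - s) ∂ρ ≤ ∫⁻ _ in Iic h, R * Q (Ioi (y - h)) ∂ρ :=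
          setLIntegral_mono measurable_const fun _ hs =>
            (hm (sub_le_sub_left hs y)).trans (hR (y - h) ⟨by linarith, by linarith⟩)
      _ ≤ R * Q (Ioi (y - h)) * ρ univ := by
          rw [setLIntegral_const]
          gcongr
          exact subset_univ _
  · rw [← lintegral_const_mul _ hQm]
    exact setLIntegral_mono (hQm.const_mul _) fun s hs =>
      hR _ ⟨by linarith [hs.2], by linarith [hs.1]⟩

-- Two summands that are both large are negligible by subexponentiality; if the first summand is
-- not large, then the other one exceeds `y - h`, which costs at most `2 * δ * Q (Ioi y)`.
theorem Subexponential.exists_eventually_setLIntegral_comp_sub_le [IsProbabilityMeasure Q]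
    [SFinite ρ] (hQ : Subexponential Q) (hm : Antitone m) {C δ : ℝ≥0} (hδ : 0 < δ)
    (hρδ : ρ univ ≤ δ) (hρ : ∀ᶠ z in atTop, ρ (Ioi z) ≤ C * Q (Ioi z)) :
    ∃ h : ℝ, ∀ᶠ y in atTop, ∀ R : ℝ≥0∞, (∀ z ∈ Icc 0 y, m z ≤ R * Q (Ioi z)) →
      ∫⁻ s in Iic (y - h), m (y - s) ∂ρ ≤ R * (3 * δ * Q (Ioi y)) := by
  obtain ⟨z₀, hz₀⟩ := eventually_atTop.1 hρ
  have hε : 0 < δ / (C + 1) := by positivity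
  obtain ⟨h, hboth, hh⟩ := ((hQ.eventually_measure_both_large_le
    (NNReal.coe_pos.2 hε)).and (eventually_ge_atTop (max z₀ 0))).exists
  refine ⟨h, ?_⟩
  filter_upwards [hboth, eventually_ge_atTop (2 * h),
    (hQ.tendsto_measure_Ioi_sub_div h).eventually (gt_mem_nhds ENNReal.one_lt_two)]
    with y hlarge hy hlong R hR
  refine (setLIntegral_comp_sub_le hm ((le_max_right _ _).trans hh) hy hR).trans ?_
  have hsmall : Q (Ioi (y - h)) ≤ 2 * Q (Ioi y) :=
    (ENNReal.div_le_iff (hQ.measure_Ioi_pos y).ne' (measure_ne_top _ _)).1 hlong.le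
  gcongr
  calc Q (Ioi (y - h)) * ρ univ + ∫⁻ s in Ioc h (y - h), Q (Ioi (y - s)) ∂ρ
      ≤ 2 * Q (Ioi y) * δ + C * ((δ / (C + 1) : ℝ≥0) * Q (Ioi y)) := by
        rw [ENNReal.ofReal_coe_nnreal] at hlarge
        refine add_le_add (mul_le_mul' hsmall hρδ) ?_
        refine (lintegral_tail_le_prod (fun z hz => hz₀ z ?_) y).trans (by gcongr)
        exact ((le_max_left _ _).trans hh).trans hz
    _ ≤ 2 * Q (Ioi y) * δ + δ * Q (Ioi y) := by
        rw [← mul_assoc, ← ENNReal.coe_mul]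
        gcongr
        rw [mul_div_left_comm]
        exact mul_le_of_le_one_right' (div_le_one_of_le₀ (le_add_of_nonneg_right zero_le_one)
          zero_le)
    _ = 3 * δ * Q (Ioi y) := by ring

end Core

section UpperBound

variable {E Ω : Type*} [MeasurableSpace E] [MeasurableSpace Ω] {Pr : Measure Ω} {P : Kernel E ℝ}
  {X : ℕ → Ω → E} {ξ : ℕ → E → Ω → ℝ} {𝓗 : ℕ → MeasurableSpace Ω} {F G : Measure ℝ} {L : ℝ≥0∞}

theorem jumpSum_le_mul_intTail [IsProbabilityMeasure Pr]
    (hL : ∀ x y, P x (Ioi y) ≤ L * F (Ioi y)) {α : ℝ} (hα : 0 < α) (B : Set E) (w : ℝ) :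
    jumpSum Pr P X B α w ≤ L / ENNReal.ofReal α * intTail F w := by
  have hα0 : ENNReal.ofReal α ≠ 0 := (ENNReal.ofReal_pos.2 hα).ne'
  calc jumpSum Pr P X B α w ≤ L * ∑' n : ℕ, F (Ioi (w + α * (n + 1))) := by
        rw [← ENNReal.tsum_mul_left]
        exact ENNReal.tsum_le_tsum fun n => jumpProb_le hL (n + 1) _
    _ = L / ENNReal.ofReal α
          * (ENNReal.ofReal α * ∑' n : ℕ, F (Ioi (w + α * (n + 1)))) := by
        rw [← mul_assoc, ENNReal.div_mul_cancel hα0 ENNReal.ofReal_ne_top]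
    _ ≤ L / ENNReal.ofReal α * intTail F w := by
        gcongr
        exact ofReal_mul_tsum_measure_Ioi_le F hα w

theorem exists_eventually_jumpSum_sub_le [IsProbabilityMeasure Pr] [IsFiniteMeasure F]
    (hF : Subexponential (secondTailDist F)) (hLtop : L ≠ ∞)
    (hL : ∀ x y, P x (Ioi y) ≤ L * F (Ioi y)) {α : ℝ} (hα : 0 < α) (κ : ℝ) :
    ∃ C : ℝ≥0, ∀ᶠ z in atTop,
      jumpSum Pr P X univ α (z - κ) ≤ C * secondTailDist F (Ioi z) := by
  have := hF.isProbabilityMeasure_secondTailDist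
  have hCtop : L / ENNReal.ofReal α * 2 ≠ ∞ :=
    ENNReal.mul_ne_top (ENNReal.div_ne_top hLtop (ENNReal.ofReal_pos.2 hα).ne') (by simp)
  refine ⟨(L / ENNReal.ofReal α * 2).toNNReal, ?_⟩
  filter_upwards [(hF.tendsto_intTail_sub_div κ).eventually (gt_mem_nhds ENNReal.one_lt_two)]
    with z hz
  rw [ENNReal.coe_toNNReal hCtop, mul_assoc]
  refine (jumpSum_le_mul_intTail hL hα univ _).trans ?_
  gcongr
  exact (ENNReal.div_le_iff (hF.measure_Ioi_pos z).ne' (measure_ne_top _ _)).1 hz.le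

-- For the i.i.d. walk with step law `G` the left-hand side is `exceedProb G y` itself, so that the
-- estimate then bounds the ratio `exceedProb G / Q` by a contraction.
theorem IsHistory.exists_measure_exceed_le_jumpSum_add [IsProbabilityMeasure Pr]
    [IsMarkovKernel P] [IsFiniteMeasure F] [IsProbabilityMeasure G] (h : IsHistory Pr P X ξ 𝓗)
    (hF : Subexponential (secondTailDist F)) (hLtop : L ≠ ∞)
    (hL : ∀ x y, P x (Ioi y) ≤ L * F (Ioi y)) (hG : ∀ x y, P x (Ioi y) ≤ G (Ioi y))
    {a : ℝ} (hdrift : HasDrift Pr X ξ a) {α : ℝ} (hα : 0 < α) (hαa : α < a) {δ : ℝ≥0}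
    (hδ : 0 < δ) :
    ∃ κ : ℝ, ∀ᶠ y in atTop, ∀ R : ℝ≥0∞,
      (∀ z ∈ Icc 0 y, exceedProb G z ≤ R * secondTailDist F (Ioi z)) →
        Pr {ω | ∃ k, y < walk X ξ k ω}
          ≤ jumpSum Pr P X univ α (y - κ) + R * (δ * secondTailDist F (Ioi y)) := by
  have := hF.isProbabilityMeasure_secondTailDist
  have hδ3 : 0 < δ / 3 := by positivity
  have hδ_eq : 3 * (δ / 3 : ℝ≥0) = (δ : ℝ≥0∞) := by
    rw [← ENNReal.coe_ofNat, ← ENNReal.coe_mul, mul_div_cancel₀ _ three_ne_zero]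
  obtain ⟨K, hK, hbarrier⟩ := h.exists_barrier hdrift hαa (ENNReal.coe_pos.2 hδ3)
  set ρ := passageLaw Pr X ξ K α
  have hmass : ρ univ ≤ (δ / 3 : ℝ≥0) := h.passageLaw_univ_le.trans hbarrier
  have : IsFiniteMeasure ρ := ⟨hmass.trans_lt ENNReal.coe_lt_top⟩
  obtain ⟨C, hC⟩ := exists_eventually_jumpSum_sub_le (Pr := Pr) (X := X) hF hLtop hL hα (K + α)
  obtain ⟨v, hv⟩ := hF.exists_eventually_setLIntegral_comp_sub_le
    (exceedProb_antitone (G := G)) hδ3 hmass (hC.mono fun z hz => (h.passageLaw_Ioi_le z).trans hz)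
  refine ⟨v + (K + α), ?_⟩
  filter_upwards [hv, eventually_ge_atTop K] with y hfar hy R hR
  refine (h.measure_exceed_le_passageLaw hG hK hα.le hy (y - v)).trans (add_le_add ?_ ?_)
  · rw [← sub_sub]
    exact h.passageLaw_Ioi_le (y - v)
  · rw [← hδ_eq]
    exact hfar R hR

theorem exists_le_mul_of_forall_le_add_half {m q : ℝ → ℝ≥0∞} (hm : ∀ z, m z ≤ 1)
    (hq : Antitone q) (hpos : ∀ z, 0 < q z) (hfin : ∀ z, q z ≠ ∞) {A : ℝ≥0∞} (hA : A ≠ ∞)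
    (hstep : ∀ᶠ y in atTop, ∀ R : ℝ≥0∞, (∀ z ∈ Icc 0 y, m z ≤ R * q z) →
      m y ≤ (A + R / 2) * q y) :
    ∃ R : ℝ≥0∞, R ≠ ∞ ∧ ∀ y, 0 ≤ y → m y ≤ R * q y := by
  obtain ⟨y₀, hy₀⟩ := eventually_atTop.1 hstep
  have hdiv {z w : ℝ} (hzw : z ≤ w) : m z / q z ≤ (q w)⁻¹ :=
    (ENNReal.div_le_div (hm z) (hq hzw)).trans_eq (one_div _)
  refine ⟨2 * (A + (q y₀)⁻¹), ENNReal.mul_ne_top (by simp)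
    (ENNReal.add_ne_top.2 ⟨hA, (ENNReal.inv_lt_top.2 (hpos y₀)).ne⟩), fun y hy => ?_⟩
  set R : ℝ≥0∞ := ⨆ z ∈ Icc 0 y, m z / q z
  have hR (z : ℝ) (hz : z ∈ Icc 0 y) : m z ≤ R * q z :=
    (ENNReal.div_le_iff (hpos z).ne' (hfin z)).1 (le_iSup₂ (f := fun z _ => m z / q z) z hz)
  have hRfin : R ≠ ∞ :=
    ((iSup₂_le fun z hz => hdiv hz.2).trans_lt (ENNReal.inv_lt_top.2 (hpos y))).ne
  have hself : R ≤ A + (q y₀)⁻¹ + R / 2 := by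
    refine iSup₂_le fun z hz => ?_
    rcases le_or_gt y₀ z with hz' | hz'
    · rw [add_right_comm]
      refine le_add_right ((ENNReal.div_le_iff (hpos z).ne' (hfin z)).2 (hy₀ z hz' R ?_))
      exact fun w hw => hR w ⟨hw.1, hw.2.trans hz.2⟩
    · exact (hdiv hz'.le).trans (le_add_self.trans le_self_add)
  have hhalf : R / 2 ≤ A + (q y₀)⁻¹ := by
    nth_rewrite 1 [← ENNReal.add_halves R] at hself
    exact (ENNReal.add_le_add_iff_right (ENNReal.div_lt_top hRfin two_ne_zero).ne).1 hself
  calc m y ≤ R * q y := hR y ⟨hy, le_rfl⟩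
    _ = 2 * (R / 2) * q y := by rw [two_mul, ENNReal.add_halves]
    _ ≤ 2 * (A + (q y₀)⁻¹) * q y := by gcongr

theorem Subexponential.exists_exceedProb_le [IsFiniteMeasure F] [IsProbabilityMeasure G]
    (hF : Subexponential (secondTailDist F)) (hG : Integrable (fun t : ℝ => t) G)
    (hneg : ∫ t, t ∂G < 0) (hLtop : L ≠ ∞) (hL : ∀ y, G (Ioi y) ≤ L * F (Ioi y)) :
    ∃ R : ℝ≥0∞, R ≠ ∞ ∧ ∀ y, 0 ≤ y → exceedProb G y ≤ R * secondTailDist F (Ioi y) := by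
  have := hF.isProbabilityMeasure_secondTailDist
  obtain ⟨𝓗, h⟩ := (isModulated_infinitePi G).exists_isHistory
  obtain ⟨α, hα, hαb⟩ := exists_between (neg_pos.2 hneg)
  have hL' (x : Unit) (y : ℝ) : Kernel.const Unit G x (Ioi y) ≤ L * F (Ioi y) := hL y
  obtain ⟨κ, hκ⟩ := h.exists_measure_exceed_le_jumpSum_add hF hLtop hL' (G := G)
    (fun _ _ => le_rfl) (hasDrift_infinitePi G hG) hα hαb (δ := 1 / 2) (by positivity)
  obtain ⟨C, hC⟩ := exists_eventually_jumpSum_sub_le (Pr := Measure.infinitePi fun _ : ℕ => G)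
    (X := fun _ _ => ()) hF hLtop hL' hα κ
  refine exists_le_mul_of_forall_le_add_half (A := C) exceedProb_le_one
    (fun y z hyz => measure_mono (Ioi_subset_Ioi hyz)) hF.measure_Ioi_pos
    (fun z => measure_ne_top _ _) ENNReal.coe_ne_top ?_
  filter_upwards [hκ, hC] with y hexceed hjump R hR
  refine (h.exceedProb_le (fun x => Kernel.const_apply _ _) y).trans ((hexceed R hR).trans ?_)
  have hhalf : R * ((1 / 2 : ℝ≥0) * secondTailDist F (Ioi y))
      = R / 2 * secondTailDist F (Ioi y) := by
    rw [ENNReal.coe_div two_ne_zero, ← mul_assoc, ENNReal.coe_one, mul_one_div, ENNReal.coe_ofNat]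
  rw [add_mul, hhalf]
  gcongr

end UpperBound

theorem tendsto_div_ofReal (C : ℝ≥0∞) (a : ℝ) :
    Tendsto (fun α => C / ENNReal.ofReal α) (𝓝 a) (𝓝 (C / ENNReal.ofReal a)) :=
  ENNReal.Tendsto.const_div ENNReal.continuous_ofReal.continuousAt (.inl ENNReal.ofReal_ne_top)

section JumpLimit

variable {E Ω : Type*} [MeasurableSpace E] [MeasurableSpace Ω] {Pr : Measure Ω} {P : Kernel E ℝ}
  {X : ℕ → Ω → E} {ξ : ℕ → E → Ω → ℝ} {𝓗 : ℕ → MeasurableSpace Ω} {F : Measure ℝ} {L : ℝ≥0∞}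
  {π : Measure E} {γ : E → ℝ≥0∞} {d : ℕ} {a : ℝ}

theorem IsHistory.tendsto_jumpSum_sub_div [IsProbabilityMeasure Pr] [IsFiniteMeasure F]
    [IsFiniteMeasure π] (h : IsHistory Pr P X ξ 𝓗) (hF : Subexponential (secondTailDist F))
    {B : Set E} (hB : MeasurableSet B) (hLtop : L ≠ ∞) (hL : ∀ x y, P x (Ioi y) ≤ L * F (Ioi y))
    (hγ : ∀ x, Tendsto (fun z => P x (Ioi z) / F (Ioi z)) atTop (𝓝 (γ x))) (hd : 0 < d)
    (hC1 : ConvergesInMean Pr X d π) {α : ℝ} (hα : 0 < α) (κ : ℝ) :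
    Tendsto (fun y => jumpSum Pr P X B α (y - κ) / secondTailDist F (Ioi y)) atTop
      (𝓝 ((∫⁻ x in B, γ x ∂π) / ENNReal.ofReal α)) := by
  have := hF.isProbabilityMeasure_secondTailDist
  exact hF.tendsto_comp_sub_div (tendsto_jumpSum_div hF
    (fun n hn => (h.measurable_X 0 n hn).mono (h.le 0) le_rfl) hB hLtop hL hγ hd hC1 hα) κ

theorem IsHistory.eventually_measure_exceed_div_lt [IsProbabilityMeasure Pr] [IsMarkovKernel P]
    [IsFiniteMeasure F] [IsFiniteMeasure π] (h : IsHistory Pr P X ξ 𝓗)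
    (hF : Subexponential (secondTailDist F)) (hLtop : L ≠ ∞)
    (hL : ∀ x y, P x (Ioi y) ≤ L * F (Ioi y))
    (hγ : ∀ x, Tendsto (fun z => P x (Ioi z) / F (Ioi z)) atTop (𝓝 (γ x))) (hd : 0 < d)
    (hC1 : ConvergesInMean Pr X d π) (ha : 0 < a) (hdrift : HasDrift Pr X ξ a)
    {G : Measure ℝ} [IsProbabilityMeasure G] (hG : Integrable (fun t : ℝ => t) G)
    (hneg : ∫ t, t ∂G < 0) (hGF : ∀ y, G (Ioi y) ≤ L * F (Ioi y))
    (hPG : ∀ x y, P x (Ioi y) ≤ G (Ioi y)) {u : ℝ≥0∞}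
    (hu : (∫⁻ x, γ x ∂π) / ENNReal.ofReal a < u) :
    ∀ᶠ y in atTop, Pr {ω | ∃ k, y < walk X ξ k ω} / secondTailDist F (Ioi y) < u := by
  have := hF.isProbabilityMeasure_secondTailDist
  obtain ⟨α, ⟨hαu, hα⟩, hαa⟩ := (((((tendsto_div_ofReal _ a).eventually (gt_mem_nhds hu)).and
    (lt_mem_nhds ha)).filter_mono nhdsWithin_le_nhds).and self_mem_nhdsWithin :
      ∀ᶠ α in 𝓝[<] a, _).exists
  obtain ⟨w, hw, hwu⟩ := exists_between hαu
  obtain ⟨R, hRtop, hR⟩ := hF.exists_exceedProb_le hG hneg hLtop hGF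
  obtain ⟨δ, hδ, hδR⟩ := ENNReal.exists_nnreal_pos_mul_lt hRtop (tsub_pos_of_lt hwu).ne'
  obtain ⟨κ, hκ⟩ := h.exists_measure_exceed_le_jumpSum_add hF hLtop hL hPG hdrift hα hαa hδ
  have hjump := h.tendsto_jumpSum_sub_div hF MeasurableSet.univ hLtop hL hγ hd hC1 hα κ
  rw [Measure.restrict_univ] at hjump
  filter_upwards [hκ, hjump.eventually (gt_mem_nhds hw)] with y hexceed hlt
  have hQ := (hF.measure_Ioi_pos y).ne'
  calc Pr {ω | ∃ k, y < walk X ξ k ω} / secondTailDist F (Ioi y)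
      ≤ (jumpSum Pr P X univ α (y - κ) + R * (δ * secondTailDist F (Ioi y)))
          / secondTailDist F (Ioi y) :=
        ENNReal.div_le_div_right (hexceed R fun z hz => hR z hz.1) _
    _ = jumpSum Pr P X univ α (y - κ) / secondTailDist F (Ioi y) + δ * R := by
        rw [ENNReal.add_div, ← mul_assoc, ENNReal.mul_div_cancel_right hQ (measure_ne_top _ _),
          mul_comm R]
    _ < w + (u - w) := ENNReal.add_lt_add hlt hδR
    _ = u := add_tsub_cancel_of_le hwu.le

end JumpLimit

/-! ### Lower bounds for the supremum -/

/-- The event `{M > y, X_{μ(y)} ∈ B}`. -/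
def passageIn {E Ω : Type*} (X : ℕ → Ω → E) (ξ : ℕ → E → Ω → ℝ) (B : Set E) (y : ℝ) : Set Ω :=
  {ω | (y : EReal) < walkSup X ξ ω ∧ X (passageTime X ξ y ω) ω ∈ B}

/-- The event that the walk has stayed below `K` up to time `n` and is not far below its drift at
time `n`. -/
def typicalPast {E Ω : Type*} (X : ℕ → Ω → E) (ξ : ℕ → E → Ω → ℝ) (K β : ℝ) (n : ℕ) : Set Ω :=
  {ω | -K - β * n ≤ walk X ξ n ω ∧ ∀ k ≤ n, walk X ξ k ω ≤ K}

section PassageIn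

variable {E Ω : Type*} {X : ℕ → Ω → E} {ξ : ℕ → E → Ω → ℝ} {B : Set E} {y : ℝ} {ω : Ω}

theorem lt_walkSup_iff : (y : EReal) < walkSup X ξ ω ↔ ∃ k, y < walk X ξ k ω := by
  simp [walkSup, lt_iSup_iff]

theorem passageTime_eq_of_mem_firstPassage {n : ℕ}
    (hω : ω ∈ firstPassage X ξ y 0 (n + 1)) : passageTime X ξ y ω = n + 1 := by
  simp only [firstPassage, zero_mul, sub_zero] at hω
  refine IsLeast.csInf_eq ⟨⟨n.succ_pos, hω.1⟩, fun j hj => ?_⟩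
  exact not_lt.1 fun hlt => (hω.2 j hlt).not_gt hj.2

theorem passageIn_eq_iUnion (hy : 0 ≤ y) (B : Set E) :
    passageIn X ξ B y = ⋃ n, firstPassage X ξ y 0 (n + 1) ∩ X (n + 1) ⁻¹' B := by
  ext ω
  simp only [passageIn, mem_ofPred_eq, lt_walkSup_iff, mem_iUnion, mem_inter_iff, mem_preimage]
  constructor
  · rintro ⟨⟨k, hk⟩, hB⟩
    obtain ⟨n, -, hn⟩ := exists_mem_firstPassage (X := X) (ξ := ξ) (α := 0) (k := k) hy (by simpa)
    exact ⟨n, hn, passageTime_eq_of_mem_firstPassage hn ▸ hB⟩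
  · rintro ⟨n, hn, hB⟩
    rw [passageTime_eq_of_mem_firstPassage hn]
    exact ⟨⟨n + 1, by simpa using hn.1⟩, hB⟩

theorem passageIn_union_compl : passageIn X ξ B y ∪ passageIn X ξ Bᶜ y
    = {ω | ∃ k, y < walk X ξ k ω} := by
  ext ω
  simp only [passageIn, mem_union, mem_ofPred_eq, mem_compl_iff, lt_walkSup_iff]
  tauto

theorem disjoint_passageIn_compl : Disjoint (passageIn X ξ B y) (passageIn X ξ Bᶜ y) :=
  Set.disjoint_left.2 fun _ hB hBc => hBc.2 hB.2

theorem pairwise_disjoint_firstPassage_inter (y : ℝ) (B : Set E) :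
    Pairwise (Function.onFun Disjoint
      fun n => firstPassage X ξ y 0 (n + 1) ∩ X (n + 1) ⁻¹' B) := fun _ _ hmn =>
  (pairwise_disjoint_firstPassage y 0 (by lia)).mono inter_subset_left inter_subset_left

variable [MeasurableSpace E] [MeasurableSpace Ω] {Pr : Measure Ω} {P : Kernel E ℝ}
  {𝓗 : ℕ → MeasurableSpace Ω}

theorem IsHistory.measurableSet_firstPassage_inter (h : IsHistory Pr P X ξ 𝓗)
    (hB : MeasurableSet B) (y : ℝ) (n : ℕ) :
    MeasurableSet (firstPassage X ξ y 0 (n + 1) ∩ X (n + 1) ⁻¹' B) :=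
  (h.le _ _ (h.measurableSet_firstPassage y 0 (n + 1))).inter
    (h.le 0 _ (h.measurable_X 0 (n + 1) (by lia) hB))

theorem IsHistory.measurableSet_passageIn (h : IsHistory Pr P X ξ 𝓗) (hB : MeasurableSet B)
    (hy : 0 ≤ y) : MeasurableSet (passageIn X ξ B y) := by
  rw [passageIn_eq_iUnion hy]
  exact MeasurableSet.iUnion fun n => h.measurableSet_firstPassage_inter hB y n

theorem IsHistory.measure_passageIn (h : IsHistory Pr P X ξ 𝓗) (hB : MeasurableSet B)
    (hy : 0 ≤ y) : Pr (passageIn X ξ B y)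
      = ∑' n, Pr (firstPassage X ξ y 0 (n + 1) ∩ X (n + 1) ⁻¹' B) := by
  rw [passageIn_eq_iUnion hy, measure_iUnion (pairwise_disjoint_firstPassage_inter y B)
    fun n => h.measurableSet_firstPassage_inter hB y n]

theorem IsHistory.measurableSet_typicalPast (h : IsHistory Pr P X ξ 𝓗) (K β : ℝ) (n : ℕ) :
    MeasurableSet[𝓗 n] (typicalPast X ξ K β n) := by
  refine (measurableSet_le measurable_const (h.measurable_walk_of_le le_rfl)).inter
    (?_ : MeasurableSet[𝓗 n] {ω | ∀ k ≤ n, walk X ξ k ω ≤ K})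
  simp only [ofPred_forall]
  exact MeasurableSet.iInter fun k => MeasurableSet.iInter fun hk =>
    measurableSet_le (h.measurable_walk_of_le hk) measurable_const

variable {a : ℝ}

theorem IsHistory.exists_measure_compl_typicalPast_le [IsFiniteMeasure Pr]
    (h : IsHistory Pr P X ξ 𝓗) (hdrift : HasDrift Pr X ξ a) (ha : 0 < a) {β : ℝ} (hβ : a < β)
    {δ : ℝ≥0∞} (hδ : 0 < δ) :
    ∃ K : ℝ, 0 ≤ K ∧ ∀ n, Pr (typicalPast X ξ K β n)ᶜ ≤ δ := by
  obtain ⟨K₁, hK₁, hupper⟩ := h.exists_barrier hdrift ha (ENNReal.half_pos hδ.ne')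
  obtain ⟨K₂, -, hlower⟩ := h.exists_lower_barrier hdrift hβ (ENNReal.half_pos hδ.ne')
  refine ⟨max K₁ K₂, hK₁.trans (le_max_left _ _), fun n => ?_⟩
  refine (measure_mono fun ω hω => ?_).trans (((measure_union_le _ _).trans
    (add_le_add hupper hlower)).trans_eq (ENNReal.add_halves δ))
  contrapose! hω
  simp only [mem_union, mem_ofPred_eq, not_or, not_exists, not_lt, zero_mul, sub_zero] at hω
  obtain ⟨hup, hlow⟩ := hω
  refine notMem_compl_iff.2 ⟨?_, fun k _ => (hup k).trans (le_max_left _ _)⟩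
  linarith [hlow n, le_max_right K₁ K₂]

end PassageIn

section LowerBound

variable {E Ω : Type*} [MeasurableSpace E] [MeasurableSpace Ω] {Pr : Measure Ω} {P : Kernel E ℝ}
  {X : ℕ → Ω → E} {ξ : ℕ → E → Ω → ℝ} {𝓗 : ℕ → MeasurableSpace Ω} {F : Measure ℝ} {L : ℝ≥0∞}
  {B : Set E}

-- After a typical past, an increment exceeding `y + K + β (n + 1)` makes `n + 1` the first passage
-- time over `y`.
theorem IsHistory.jumpProb_le_add (h : IsHistory Pr P X ξ 𝓗)
    (hL : ∀ x y, P x (Ioi y) ≤ L * F (Ioi y)) (hB : MeasurableSet B) {K β y : ℝ} (hβ : 0 ≤ β)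
    (hy : K ≤ y) {δ : ℝ≥0∞} (hpast : ∀ n, Pr (typicalPast X ξ K β n)ᶜ ≤ δ) (n : ℕ) :
    jumpProb Pr P X B (n + 1) (y + K + β * (n + 1))
      ≤ Pr (firstPassage X ξ y 0 (n + 1) ∩ X (n + 1) ⁻¹' B)
        + δ * (L * F (Ioi (y + K + β * (n + 1)))) := by
  set z : ℝ := y + K + β * (n + 1)
  have hT := h.measurableSet_typicalPast K β n
  have hXB : MeasurableSet[𝓗 n] (X (n + 1) ⁻¹' B) := h.measurable_X n (n + 1) n.succ_pos hB
  rw [jumpProb, ← lintegral_inter_add_sdiff _ _ (h.le n _ hT), inter_comm]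
  refine add_le_add ?_ ?_
  · rw [← h.measure_inter_incr_gt n (hT.inter hXB)]
    refine measure_mono ?_
    rintro ω ⟨⟨⟨hlow, hup⟩, hXω⟩, hjump : y + K + β * (n + 1) < ξ (n + 1) (X (n + 1) ω) ω⟩
    refine ⟨⟨?_, fun k hk => ?_⟩, hXω⟩
    · rw [walk_succ]
      linarith
    · linarith [hup k (Nat.lt_succ_iff.1 hk)]
  · calc ∫⁻ ω in X (n + 1) ⁻¹' B \ typicalPast X ξ K β n, P (X (n + 1) ω) (Ioi z) ∂Pr
        ≤ ∫⁻ _ in (typicalPast X ξ K β n)ᶜ, L * F (Ioi z) ∂Pr :=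
          (lintegral_mono_set fun ω hω => hω.2).trans (lintegral_mono fun ω => hL _ _)
      _ ≤ δ * (L * F (Ioi z)) := by
          rw [setLIntegral_const, mul_comm]
          gcongr
          exact hpast n

theorem IsHistory.jumpSum_le_measure_passageIn_add (h : IsHistory Pr P X ξ 𝓗)
    (hL : ∀ x y, P x (Ioi y) ≤ L * F (Ioi y)) (hB : MeasurableSet B) {K β y : ℝ} (hK : 0 ≤ K)
    (hβ : 0 < β) (hy : K ≤ y) {δ : ℝ≥0∞} (hpast : ∀ n, Pr (typicalPast X ξ K β n)ᶜ ≤ δ) :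
    jumpSum Pr P X B β (y + K)
      ≤ Pr (passageIn X ξ B y) + δ * (L / ENNReal.ofReal β) * intTail F y := by
  have hβ0 : ENNReal.ofReal β ≠ 0 := (ENNReal.ofReal_pos.2 hβ).ne'
  calc jumpSum Pr P X B β (y + K)
      ≤ Pr (passageIn X ξ B y) + δ * L * ∑' n : ℕ, F (Ioi (y + K + β * (n + 1))) := by
        rw [h.measure_passageIn hB (hK.trans hy), ← ENNReal.tsum_mul_left, ← ENNReal.tsum_add]
        refine ENNReal.tsum_le_tsum fun n => ?_
        rw [mul_assoc]
        exact h.jumpProb_le_add hL hB hβ.le hy hpast n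
    _ = Pr (passageIn X ξ B y) + δ * (L / ENNReal.ofReal β)
          * (ENNReal.ofReal β * ∑' n : ℕ, F (Ioi (y + K + β * (n + 1)))) := by
        rw [← mul_assoc, mul_assoc δ (L / _), ENNReal.div_mul_cancel hβ0 ENNReal.ofReal_ne_top]
    _ ≤ Pr (passageIn X ξ B y) + δ * (L / ENNReal.ofReal β) * intTail F y := by
        gcongr
        exact (ofReal_mul_tsum_measure_Ioi_le F hβ _).trans (intTail_antitone F (by linarith))

variable {π : Measure E} [IsFiniteMeasure π] {γ : E → ℝ≥0∞} {d : ℕ} {a : ℝ}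

theorem IsHistory.eventually_lt_measure_passageIn_div [IsProbabilityMeasure Pr]
    [IsFiniteMeasure F] (h : IsHistory Pr P X ξ 𝓗) (hF : Subexponential (secondTailDist F))
    (hLtop : L ≠ ∞) (hL : ∀ x y, P x (Ioi y) ≤ L * F (Ioi y))
    (hγ : ∀ x, Tendsto (fun z => P x (Ioi z) / F (Ioi z)) atTop (𝓝 (γ x))) (hd : 0 < d)
    (hC1 : ConvergesInMean Pr X d π) (ha : 0 < a) (hdrift : HasDrift Pr X ξ a)
    (hB : MeasurableSet B) {l : ℝ≥0∞} (hl : l < (∫⁻ x in B, γ x ∂π) / ENNReal.ofReal a) :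
    ∀ᶠ y in atTop, l < Pr (passageIn X ξ B y) / secondTailDist F (Ioi y) := by
  have := hF.isProbabilityMeasure_secondTailDist
  obtain ⟨β, hlβ, haβ : a < β⟩ := ((((tendsto_div_ofReal _ a).eventually
    (lt_mem_nhds hl)).filter_mono nhdsWithin_le_nhds).and self_mem_nhdsWithin :
      ∀ᶠ β in 𝓝[>] a, _).exists
  have hβ : 0 < β := ha.trans haβ
  obtain ⟨w, hlw, hw⟩ := exists_between hlβ
  obtain ⟨δ, hδ, hδw⟩ := ENNReal.exists_nnreal_pos_mul_lt
    (ENNReal.div_ne_top hLtop (ENNReal.ofReal_pos.2 hβ).ne') (tsub_pos_of_lt hlw).ne'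
  obtain ⟨K, hK, hpast⟩ := h.exists_measure_compl_typicalPast_le hdrift ha haβ
    (ENNReal.coe_pos.2 hδ)
  filter_upwards [eventually_ge_atTop K, hF.eventually_secondTailDist_Ioi_eq,
    (h.tendsto_jumpSum_sub_div hF hB hLtop hL hγ hd hC1 hβ (-K)).eventually (lt_mem_nhds hw)]
    with y hy hQ hlt
  rw [sub_neg_eq_add] at hlt
  have hQpos := (hF.measure_Ioi_pos y).ne'
  have hsum : l + δ * (L / ENNReal.ofReal β)
      < Pr (passageIn X ξ B y) / secondTailDist F (Ioi y) + δ * (L / ENNReal.ofReal β) :=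
    calc l + δ * (L / ENNReal.ofReal β) ≤ l + (w - l) := by gcongr
      _ = w := add_tsub_cancel_of_le hlw.le
      _ < jumpSum Pr P X B β (y + K) / secondTailDist F (Ioi y) := hlt
      _ ≤ (Pr (passageIn X ξ B y) + δ * (L / ENNReal.ofReal β) * secondTailDist F (Ioi y))
          / secondTailDist F (Ioi y) := by
        rw [hQ]
        exact ENNReal.div_le_div_right
          (h.jumpSum_le_measure_passageIn_add hL hB hK hβ hy hpast) _
      _ = _ := by
        rw [ENNReal.add_div, ENNReal.mul_div_cancel_right hQpos (measure_ne_top _ _)]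
  exact lt_of_add_lt_add_right hsum

end LowerBound

theorem tendsto_of_eventually_lt_of_eventually_add_lt {ι : Type*} {l : Filter ι} {f g : ι → ℝ≥0∞}
    {u v : ℝ≥0∞} (hv : v ≠ ∞) (hf : ∀ b < u, ∀ᶠ i in l, b < f i)
    (hg : ∀ b < v, ∀ᶠ i in l, b < g i) (hfg : ∀ r, u + v < r → ∀ᶠ i in l, f i + g i < r) :
    Tendsto f l (𝓝 u) := by
  refine tendsto_order.2 ⟨hf, fun r hr => ?_⟩
  obtain ⟨e, he, her⟩ := ENNReal.lt_iff_exists_add_pos_lt.1 hr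
  have hhalf : (0 : ℝ≥0∞) < e / 2 := ENNReal.half_pos (ENNReal.coe_ne_zero.2 he.ne')
  have hge : ∀ᶠ i in l, v ≤ g i + e / 2 := by
    rcases eq_or_ne v 0 with rfl | hv0
    · exact Eventually.of_forall fun _ => zero_le
    · exact (hg _ (ENNReal.sub_lt_self hv hv0 hhalf.ne')).mono fun i hi =>
        tsub_le_iff_right.1 hi.le
  have huv : u + v < u + v + e / 2 :=
    ENNReal.lt_add_right (ENNReal.add_ne_top.2 ⟨hr.ne_top, hv⟩) hhalf.ne'
  filter_upwards [hge, hfg _ huv] with i hgi hsum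
  refine lt_trans (lt_of_add_lt_add_right (a := v) ?_) her
  calc f i + v ≤ f i + g i + e / 2 := by
        rw [add_assoc]
        gcongr
    _ < u + v + e / 2 + e / 2 := ENNReal.add_lt_add_right (by finiteness) hsum
    _ = u + e + v := by rw [add_assoc (u + v), ENNReal.add_halves, add_right_comm]

section TailRatio

variable {H F : Measure ℝ} {b : ℝ}

theorem tendsto_tail_div_of_isLittleO (hF : ∀ y, 0 < tail F y)
    (h : (fun y => tail H y - b * tail F y) =o[atTop] tail F) :
    Tendsto (fun y => tail H y / tail F y) atTop (𝓝 b) := by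
  refine zero_add b ▸ (h.tendsto_div_nhds_zero.add_const b).congr fun y => ?_
  rw [sub_div, mul_div_cancel_right₀ _ (hF y).ne', sub_add_cancel]

theorem tendsto_measure_Ioi_div_of_tendsto_tail_div [IsFiniteMeasure H] [IsFiniteMeasure F]
    (hF : ∀ y, 0 < tail F y) (h : Tendsto (fun y => tail H y / tail F y) atTop (𝓝 b)) :
    Tendsto (fun y => H (Ioi y) / F (Ioi y)) atTop (𝓝 (ENNReal.ofReal b)) := by
  refine (ENNReal.tendsto_ofReal h).congr fun y => ?_
  rw [ENNReal.ofReal_div_of_pos (hF y), tail, tail, ofReal_measureReal, ofReal_measureReal]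

end TailRatio

section Limit

variable {E : Type*} [MeasurableSpace E] {P : Kernel E ℝ} {F : Measure ℝ} {c : E → ℝ}

theorem measurable_of_tendsto_tail_div
    (hc : ∀ x, Tendsto (fun y => tail (P x) y / tail F y) atTop (𝓝 (c x))) : Measurable c :=
  measurable_of_tendsto_metrizable
    (fun _ => (P.measurable_coe measurableSet_Ioi).ennreal_toReal.div_const _)
    (tendsto_pi_nhds.2 fun x => (hc x).comp tendsto_natCast_atTop_atTop)

theorem toReal_lintegral_ofReal_div {π : Measure E} (hc : Measurable c) (hc0 : ∀ x, 0 ≤ c x)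
    {a : ℝ} (ha : 0 ≤ a) :
    ((∫⁻ x, ENNReal.ofReal (c x) ∂π) / ENNReal.ofReal a).toReal = (∫ x, c x ∂π) / a := by
  rw [ENNReal.toReal_div, ENNReal.toReal_ofReal ha,
    integral_eq_lintegral_of_nonneg_ae (Eventually.of_forall hc0) hc.aestronglyMeasurable]

theorem exists_measure_Ioi_le_mul [IsMarkovKernel P] [IsFiniteMeasure F] (hF : 0 < F (Ioi 0))
    (hcomp : ∃ L : ℝ, ∀ x, ∀ y, 0 ≤ y → tail (P x) y ≤ L * tail F y) :
    ∃ L : ℝ≥0, 1 ≤ L * F (Ioi 0) ∧ ∀ x y, P x (Ioi y) ≤ L * F (Ioi y) := by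
  obtain ⟨L, hL⟩ := hcomp
  set L' : ℝ≥0 := max L.toNNReal (F (Ioi 0))⁻¹.toNNReal
  have hone : 1 ≤ L' * F (Ioi 0) := by
    rw [← ENNReal.inv_mul_cancel hF.ne' (measure_ne_top _ _),
      ← ENNReal.coe_toNNReal (ENNReal.inv_ne_top.2 hF.ne')]
    gcongr
    exact le_max_right _ _
  refine ⟨L', hone, fun x y => ?_⟩
  rcases lt_or_ge y 0 with hy | hy
  · calc P x (Ioi y) ≤ 1 := prob_le_one
      _ ≤ L' * F (Ioi 0) := hone
      _ ≤ L' * F (Ioi y) := by gcongr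
  · calc P x (Ioi y) = ENNReal.ofReal (tail (P x) y) := by rw [tail, ofReal_measureReal]
      _ ≤ ENNReal.ofReal (L * tail F y) := ENNReal.ofReal_le_ofReal (hL x y hy)
      _ = L.toNNReal * F (Ioi y) := by
        rw [tail, ENNReal.ofReal_mul' measureReal_nonneg, ofReal_measureReal, ENNReal.ofReal]
      _ ≤ L' * F (Ioi y) := by
        gcongr
        exact le_max_left _ _

-- Capping the tail of `G` by that of `L F` leaves it a dominating law, and lowers its mean.
theorem exists_dominating_law [IsMarkovKernel P] [IsProbabilityMeasure F] {L : ℝ≥0}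
    (hL0 : 1 ≤ L * F (Ioi 0)) (hL : ∀ x y, P x (Ioi y) ≤ L * F (Ioi y))
    (hG : ∃ G : Measure ℝ, IsProbabilityMeasure G ∧ Integrable (fun t : ℝ => t) G ∧
      ∫ t, t ∂G < 0 ∧ ∀ x y, tail (P x) y ≤ tail G y) :
    ∃ G : Measure ℝ, IsProbabilityMeasure G ∧ Integrable (fun t : ℝ => t) G ∧ ∫ t, t ∂G < 0 ∧
      (∀ y, G (Ioi y) ≤ L * F (Ioi y)) ∧ ∀ x y, P x (Ioi y) ≤ G (Ioi y) := by
  obtain ⟨G, _, hint, hneg, hPG⟩ := hG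
  obtain ⟨G', hprob, hint', hle, hG'⟩ := exists_law_min_tail hint hL0
  refine ⟨G', hprob, hint', hle.trans_lt hneg, fun y => (hG' y).trans_le (min_le_right _ _),
    fun x y => (le_min ?_ (hL x y)).trans_eq (hG' y).symm⟩
  exact (ENNReal.toReal_le_toReal (measure_ne_top _ _) (measure_ne_top _ _)).1 (hPG x y)

variable {L : ℝ≥0∞} {π : Measure E} [IsFiniteMeasure π] {γ : E → ℝ≥0∞}

theorem lintegral_ne_top_of_tendsto_measure_Ioi_div (hLtop : L ≠ ∞)
    (hL : ∀ x y, P x (Ioi y) ≤ L * F (Ioi y))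
    (hγ : ∀ x, Tendsto (fun z => P x (Ioi z) / F (Ioi z)) atTop (𝓝 (γ x))) (B : Set E) :
    ∫⁻ x in B, γ x ∂π ≠ ∞ := by
  have hγL : ∀ x, γ x ≤ L := fun x =>
    le_of_tendsto' (hγ x) fun y => ENNReal.div_le_of_le_mul (hL x y)
  refine ((lintegral_mono hγL).trans_lt ?_).ne
  rw [lintegral_const]
  finiteness

variable [IsMarkovKernel P] [IsFiniteMeasure F] {Ω : Type*} [MeasurableSpace Ω] {Pr : Measure Ω}
  [IsProbabilityMeasure Pr] {X : ℕ → Ω → E} {ξ : ℕ → E → Ω → ℝ} {𝓗 : ℕ → MeasurableSpace Ω}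
  {d : ℕ} {a : ℝ} {G : Measure ℝ} [IsProbabilityMeasure G] {B : Set E}

theorem IsHistory.tendsto_measure_passageIn_div (h : IsHistory Pr P X ξ 𝓗)
    (hF : Subexponential (secondTailDist F)) (hLtop : L ≠ ∞)
    (hL : ∀ x y, P x (Ioi y) ≤ L * F (Ioi y))
    (hγ : ∀ x, Tendsto (fun z => P x (Ioi z) / F (Ioi z)) atTop (𝓝 (γ x))) (hd : 0 < d)
    (hC1 : ConvergesInMean Pr X d π) (ha : 0 < a) (hdrift : HasDrift Pr X ξ a)
    (hG : Integrable (fun t : ℝ => t) G) (hneg : ∫ t, t ∂G < 0)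
    (hGF : ∀ y, G (Ioi y) ≤ L * F (Ioi y)) (hPG : ∀ x y, P x (Ioi y) ≤ G (Ioi y))
    (hB : MeasurableSet B) :
    Tendsto (fun y => Pr (passageIn X ξ B y) / secondTailDist F (Ioi y)) atTop
      (𝓝 ((∫⁻ x in B, γ x ∂π) / ENNReal.ofReal a)) := by
  have hlower : ∀ A, MeasurableSet A → ∀ l < (∫⁻ x in A, γ x ∂π) / ENNReal.ofReal a,
      ∀ᶠ y in atTop, l < Pr (passageIn X ξ A y) / secondTailDist F (Ioi y) := fun A hA l hl =>
    h.eventually_lt_measure_passageIn_div hF hLtop hL hγ hd hC1 ha hdrift hA hl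
  refine tendsto_of_eventually_lt_of_eventually_add_lt
    (ENNReal.div_ne_top (lintegral_ne_top_of_tendsto_measure_Ioi_div hLtop hL hγ Bᶜ)
      (ENNReal.ofReal_pos.2 ha).ne') (hlower B hB) (hlower Bᶜ hB.compl) fun r hr => ?_
  rw [← ENNReal.add_div, lintegral_add_compl γ hB] at hr
  filter_upwards [eventually_ge_atTop 0, h.eventually_measure_exceed_div_lt hF hLtop hL hγ hd hC1
    ha hdrift hG hneg hGF hPG hr] with y hy hlt
  rwa [← ENNReal.add_div, ← measure_union disjoint_passageIn_compl
    (h.measurableSet_passageIn hB.compl hy), passageIn_union_compl]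

end Limit

end ModulatedWalk

open ModulatedWalk in
theorem theorem2_general {E Ω : Type*} [MeasurableSpace E] [MeasurableSpace Ω]
    (Pr : Measure Ω) [IsProbabilityMeasure Pr] (P : Kernel E ℝ) [IsMarkovKernel P]
    (X : ℕ → Ω → E) (ξ : ℕ → E → Ω → ℝ) (hmod : IsModulated Pr P X ξ)
    (F : Measure ℝ) [IsProbabilityMeasure F]
    (c : E → ℝ) (htail : ∀ x, (fun y => tail (P x) y - c x * tail F y) =o[atTop] tail F)
    (hcomp : ∃ L : ℝ, ∀ x, ∀ y, 0 ≤ y → tail (P x) y ≤ L * tail F y)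
    (π : Measure E) [IsProbabilityMeasure π] (d : ℕ) (hd : 0 < d) (hC1 : ConvergesInMean Pr X d π)
    (a : ℝ) (ha : 0 < a) (hC2 : HasDrift Pr X ξ a) (hsub : Subexponential (secondTailDist F))
    (hG : ∃ G : Measure ℝ, IsProbabilityMeasure G ∧ Integrable (fun t : ℝ => t) G ∧
      ∫ t, t ∂G < 0 ∧ ∀ x y, tail (P x) y ≤ tail G y)
    (B : Set E) (hB : MeasurableSet B) :
    Tendsto
      (fun y : ℝ => Pr.real {ω | (y : EReal) < walkSup X ξ ω ∧ X (passageTime X ξ y ω) ω ∈ B} /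
        secondTail F y)
      atTop (𝓝 ((∫ x in B, c x ∂π) / a)) := by
  have hFpos : ∀ y, 0 < tail F y := fun y =>
    ENNReal.toReal_pos (hsub.reference_measure_Ioi_pos y).ne' (measure_ne_top _ _)
  have hc := fun x => tendsto_tail_div_of_isLittleO hFpos (htail x)
  have hγ := fun x => tendsto_measure_Ioi_div_of_tendsto_tail_div hFpos (hc x)
  have hc0 : ∀ x, 0 ≤ c x := fun x =>
    ge_of_tendsto' (hc x) fun y => div_nonneg measureReal_nonneg measureReal_nonneg
  obtain ⟨𝓗, h⟩ := hmod.exists_isHistory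
  obtain ⟨L, hL0, hL⟩ := exists_measure_Ioi_le_mul (hsub.reference_measure_Ioi_pos 0) hcomp
  obtain ⟨G, _, hGint, hneg, hGF, hPG⟩ := exists_dominating_law hL0 hL hG
  have hlim := h.tendsto_measure_passageIn_div hsub ENNReal.coe_ne_top hL hγ hd hC1 ha hC2 hGint
    hneg hGF hPG hB
  have hfin := ENNReal.div_ne_top (lintegral_ne_top_of_tendsto_measure_Ioi_div (π := π)
    ENNReal.coe_ne_top hL hγ B) (ENNReal.ofReal_pos.2 ha).ne'
  rw [← toReal_lintegral_ofReal_div (measurable_of_tendsto_tail_div hc) hc0 ha.le]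
  refine ((ENNReal.tendsto_toReal hfin).comp hlim).congr fun y => ?_
  rw [← hsub.tail_secondTailDist]
  exact ENNReal.toReal_div _ _

theorem theorem2 {E Ω : Type*} [MeasurableSpace E] [MeasurableSpace Ω]
    -- the modulated random walk
    (Pr : Measure Ω) [IsProbabilityMeasure Pr] (P : Kernel E ℝ) [IsMarkovKernel P]
    (X : ℕ → Ω → E) (ξ : ℕ → E → Ω → ℝ) (hmod : ModulatedWalk.IsModulated Pr P X ξ)
    -- each `F_x` has a finite mean
    (hmean : ∀ x, Integrable (fun t : ℝ => t) (P x))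
    -- the reference distribution `F` on `[0, ∞)`, with finite mean
    (F : Measure ℝ) [IsProbabilityMeasure F] (hFpos : F (Iio 0) = 0)
    (hFmean : Integrable (fun t : ℝ => t) F)
    -- `F̄_x(y) ∼ c(x) F̄(y)`, read as `F̄_x(y) = o(F̄(y))` if `c(x) = 0`
    (c : E → ℝ) (hc_meas : Measurable c) (hc_nonneg : ∀ x, 0 ≤ c x)
    (htail : ∀ x, (fun y => ModulatedWalk.tail (P x) y - c x * ModulatedWalk.tail F y)
      =o[atTop] ModulatedWalk.tail F)
    (hcomp : ∃ L : ℝ, ∀ x, ∀ y, 0 ≤ y →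
      ModulatedWalk.tail (P x) y ≤ L * ModulatedWalk.tail F y)
    -- (C1)
    (π : Measure E) [IsProbabilityMeasure π] (d : ℕ) (hd : 0 < d)
    (hC1 : ModulatedWalk.ConvergesInMean Pr X d π)
    -- (C2)
    (a : ℝ) (ha : 0 < a) (hC2 : ModulatedWalk.HasDrift Pr X ξ a)
    -- `F^s` is subexponential
    (hsub : ModulatedWalk.Subexponential (ModulatedWalk.secondTailDist F))
    -- all `F_x` are dominated in tail by a distribution `G` with negative mean
    (hG : ∃ G : Measure ℝ, IsProbabilityMeasure G ∧ Integrable (fun t : ℝ => t) G ∧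
      ∫ t, t ∂G < 0 ∧ ∀ x y, ModulatedWalk.tail (P x) y ≤ ModulatedWalk.tail G y)
    (B : Set E) (hB : MeasurableSet B) :
    Tendsto
      (fun y : ℝ =>
        Pr.real {ω | (y : EReal) < ModulatedWalk.walkSup X ξ ω ∧
            X (ModulatedWalk.passageTime X ξ y ω) ω ∈ B} /
          ModulatedWalk.secondTail F y)
      atTop (𝓝 ((∫ x in B, c x ∂π) / a)) :=
  theorem2_general Pr P X ξ hmod F c htail hcomp π d hd hC1 a ha hC2 hsub hG B hB
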